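/- Let $(E,\mathcal B,m)$ be a $\sigma$-finite measure space with countably generated $\sigma$-algebra $\mathcal B$, and let $(L,D(L))$ be a negative definite self-adjoint operator on (real) $L^2(m)$ with $\operatorname{Ker}(L)=\{0\}$. Let $D(\mathcal E):=D(\sqrt{-L})$ and $\mathcal E(u,v):=\int \sqrt{-L}\,u\,\sqrt{-L}\,v\,dm$ for $u,v\in D(\mathcal E)$, let $\mathcal F_e$ be the abstract completion of $D(\mathcal E)$ with respect to the norm $\|\cdot\|_{\mathcal F_e}:=\mathcal E(\cdot,\cdot)^{1/2}$, and let $\mathcal F_e^*$ be its dual space. Assume that $(\mathcal E,D(\mathcal E))$ is a transient Dirichlet space, that is: (i) for every $u\in D(\mathcal E)$ the function $v:=(u\vee 0)\wedge 1$ belongs to $D(\mathcal E)$ and $\mathcal E(v,v)\le\mathcal E(u,u)$; (ii) for every nonnegative $f\in L^1(m)\cap L^2(m)$ the potential $Gf:=\lim_{n\to\infty}(\tfrac1n-L)^{-1}f=\int_0^\infty e^{tL}f\,dt$ (an increasing limit) is finite $m$-a.e. Then: (L1) There is a strictly positive $g\in L^1(m)\cap L^\infty(m)$ such that $\mathcal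 F_e\subset L^1(g\cdot m)$ continuously, i.e. the identity on $D(\mathcal E)$ extends to an injective bounded linear map $\mathcal F_e\to L^1(g\cdot m)$. By (L1), elements of $\mathcal F_e$ are regarded as ($m$-classes of) functions on $E$; the following holds for every $g$ as in (L1). Call $N:\mathbb R\to[0,\infty)$ a Young function if it is continuous, convex and even, $N(s)=0$ if and only if $s=0$, $\lim_{s\to0}N(s)/s=0$ and $\lim_{s\to\infty}N(s)/s=\infty$. Put $N^*(s):=\sup\{r|s|-N(r):r\ge0\}$. Call $N$ $\Delta_2$-regular if there is a constant $c>0$ such that $N(2s)\le c\,(N(s)+1_{\{m(E)<\infty\}})$ for all $s\in\mathbb R$. Let $L_N$ be the Orlicz space of all measurable $f$ with $\int N(\alpha f)\,dm<\infty$ for some $\alpha>0$, with norm $\|f\|_{L_N}:=\inf\{\lambda>0:\int N(f/\lambda)\,dm\le1\}$. Then, for every Young function $N$ such that $N$ and $N^*$ are $\Delta_2$-regular: (N1) $\mathcal F_e\cap L_{N^*}$ is a dense subset of both $\mathcal F_e$ and $L_{N^*}$. (N2) The space $$V:=\Bigl\{u\in L_N \Bigm| \exists\,c\in(0,\infty):\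 \int uv\,dm\le c\,\|v\|_{\mathcal F_e}\ \text{ for all } v\in\mathcal F_e\cap L_{N^*}\Bigr\}$$ is a dense subset of both $\mathcal F_e^*$ and $L_N$, where $u\in V$ is identified with the element of $\mathcal F_e^*$ which is given by $v\mapsto\int uv\,dm$ on $\mathcal F_e\cap L_{N^*}$. -/

import Mathlib

open MeasureTheory Filter Topology
open scoped ENNReal InnerProductSpace

/-! ### The quadratic form of a negative definite self-adjoint operator and its completion -/

section Form

variable {H : Type*} [NormedAddCommGroup H] [InnerProductSpace ℝ H]

/-- `S = √(-L)`: the operator `S` is self-adjoint and nonnegative, and `S² = -L` as unbounded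
operators, domains included.  (For a nonpositive self-adjoint `L` there is exactly one such `S`.) -/
structure IsSqrtNeg [CompleteSpace H] (L S : H →ₗ.[ℝ] H) : Prop where
  selfAdjoint : IsSelfAdjoint S
  nonneg : ∀ u : S.domain, 0 ≤ ⟪S u, (u : H)⟫_ℝ
  sq : ∀ u w : H, (u, w) ∈ L.graph ↔ ∃ z : H, (u, z) ∈ S.graph ∧ (z, -w) ∈ S.graph

/-- The form domain `D(ℰ) = D(S)`, `S = √(-L)`, as a type of its own; below it carries the
inner product `ℰ(u, v) = ⟪S u, S v⟫` instead of the inner product of the ambient space. -/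
def FormDomain (S : H →ₗ.[ℝ] H) : Type _ := S.domain

namespace FormDomain

variable (S : H →ₗ.[ℝ] H)

instance : AddCommGroup (FormDomain S) := inferInstanceAs (AddCommGroup S.domain)

instance : Module ℝ (FormDomain S) := inferInstanceAs (Module ℝ S.domain)

/-- The operator `S` on its domain. -/
def op : FormDomain S →ₗ[ℝ] H := S.toFun

/-- The inclusion of `D(ℰ)` into the ambient space. -/
def incl : FormDomain S →ₗ[ℝ] H := S.domain.subtype

/-- `‖u‖ = ‖S u‖ = ℰ(u, u)^{1/2}`. -/
noncomputable instance : SeminormedAddCommGroup (FormDomain S) :=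
  SeminormedAddCommGroup.induced (FormDomain S) H (op S)

/-- The inner product of `D(ℰ)` is `ℰ(u, v) = ⟪S u, S v⟫`. -/
noncomputable instance : InnerProductSpace ℝ (FormDomain S) where
  norm_smul_le a u := by
    change ‖op S (a • u)‖ ≤ ‖a‖ * ‖op S u‖
    rw [map_smul, norm_smul]
  inner u v := ⟪op S u, op S v⟫_ℝ
  norm_sq_eq_re_inner u := by
    change ‖op S u‖ ^ 2 = _
    exact norm_sq_eq_re_inner (𝕜 := ℝ) (op S u)
  conj_inner_symm u v := inner_conj_symm (𝕜 := ℝ) (op S u) (op S v)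
  add_left u v w := by
    change ⟪op S (u + v), op S w⟫_ℝ = _
    rw [map_add, inner_add_left]
  smul_left u v a := by
    change ⟪op S (a • u), op S v⟫_ℝ = _
    rw [map_smul, inner_smul_left]

end FormDomain

/-- `ℱ_e`: the abstract completion of `D(ℰ)` for the norm `ℰ(·,·)^{1/2}`. -/
abbrev ExtendedSpace (S : H →ₗ.[ℝ] H) : Type _ := UniformSpace.Completion (FormDomain S)

end Form

/-! ### Transient Dirichlet spaces -/

section Dirichlet

variable {E : Type*} [MeasurableSpace E] (m : Measure E)

/-- The Markov property of `(ℰ, D(ℰ))`: the unit contraction operates. -/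
def IsMarkovian (S : Lp ℝ 2 m →ₗ.[ℝ] Lp ℝ 2 m) : Prop :=
  ∀ u : FormDomain S, ∃ v : FormDomain S,
    (⇑(FormDomain.incl S v) =ᵐ[m] fun x => min (max (FormDomain.incl S u x) 0) 1) ∧
      ⟪v, v⟫_ℝ ≤ ⟪u, u⟫_ℝ

/-- `u = G_α f`, where `G_α = (α - L)⁻¹` is the resolvent of `L`: `u ∈ D(L)` and
`L u = α u - f`. -/
def IsResolventAt (L : Lp ℝ 2 m →ₗ.[ℝ] Lp ℝ 2 m) (α : ℝ) (f u : Lp ℝ 2 m) : Prop :=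
  (u, α • u - f) ∈ L.graph

/-- Transience (of the semigroup generated by `L`): for nonnegative integrable `f` the potential
`G f = ∫₀^∞ e^{tL} f dt = lim_{α ↓ 0} G_α f`, an increasing limit, is finite almost everywhere.
Only square integrable `f` are tested; the potential of a strictly positive one already decides
the matter. -/
def IsTransient (L : Lp ℝ 2 m →ₗ.[ℝ] Lp ℝ 2 m) : Prop :=
  ∀ f : Lp ℝ 2 m, 0 ≤ f → Integrable f m →
    ∃ R : ℕ → Lp ℝ 2 m, (∀ n : ℕ, IsResolventAt m L (1 / ((n : ℝ) + 1)) f (R n)) ∧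
      ∀ᵐ x ∂m, BddAbove (Set.range fun n : ℕ => R n x)

/-- `(ℰ, D(ℰ))`, the form of `L` with `S = √(-L)`, is a transient Dirichlet space.  (Since `S` is
self-adjoint, the form is densely defined, symmetric and closed.) -/
structure IsTransientDirichletSpace (L S : Lp ℝ 2 m →ₗ.[ℝ] Lp ℝ 2 m) : Prop where
  markovian : IsMarkovian m S
  transient : IsTransient m L

/-- The measure `g · m`. -/
noncomputable def weighted (g : E → ℝ) : Measure E := m.withDensity fun x => ENNReal.ofReal (g x)

/-- `g` is a strictly positive element of `L¹(m) ∩ L^∞(m)`. -/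
structure IsWeight (g : E → ℝ) : Prop where
  memL1 : MemLp g 1 m
  memLinfty : MemLp g ∞ m
  pos : ∀ᵐ x ∂m, 0 < g x

/-- `J` realizes `ℱ_e` as a subspace of `L¹(g · m)`, continuously: it is an injective bounded
linear map which maps (the class of) each `u ∈ D(ℰ)` to `u` itself. -/
structure IsL1Embedding (S : Lp ℝ 2 m →ₗ.[ℝ] Lp ℝ 2 m) (g : E → ℝ)
    (J : ExtendedSpace S →L[ℝ] Lp ℝ 1 (weighted m g)) : Prop where
  weight : IsWeight m g
  injective : Function.Injective J
  extends_incl : ∀ u : FormDomain S,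
    ⇑(J (u : ExtendedSpace S)) =ᵐ[m] ⇑(FormDomain.incl S u)

/-- Condition (L1): for some strictly positive `g ∈ L¹(m) ∩ L^∞(m)`, `ℱ_e ⊂ L¹(g · m)`
continuously. -/
def ConditionL1 (S : Lp ℝ 2 m →ₗ.[ℝ] Lp ℝ 2 m) : Prop :=
  ∃ (g : E → ℝ) (J : ExtendedSpace S →L[ℝ] Lp ℝ 1 (weighted m g)), IsL1Embedding m S g J

end Dirichlet

/-! ### Young functions and Orlicz spaces -/

/-- Young functions. -/
structure IsYoungFunction (N : ℝ → ℝ) : Prop where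
  continuous : Continuous N
  nonneg : ∀ s, 0 ≤ N s
  convex : ConvexOn ℝ Set.univ N
  even : ∀ s, N (-s) = N s
  eq_zero_iff : ∀ s, N s = 0 ↔ s = 0
  tendsto_zero : Tendsto (fun s => N s / s) (𝓝[≠] 0) (𝓝 0)
  tendsto_atTop : Tendsto (fun s => N s / s) atTop atTop

/-- The dual function `N*(s) = sup {r |s| - N(r) : r ≥ 0}`. -/
noncomputable def youngDual (N : ℝ → ℝ) (s : ℝ) : ℝ :=
  sSup ((fun r : ℝ => r * |s| - N r) '' Set.Ici 0)

section Orlicz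

variable {E : Type*} [MeasurableSpace E] (m : Measure E)

open Classical in
/-- `Δ₂`-regularity: `N(2s) ≤ c (N(s) + 1_{m(E) < ∞})` for all `s`. -/
def IsDelta2Regular (N : ℝ → ℝ) : Prop :=
  ∃ c : ℝ, 0 < c ∧ ∀ s : ℝ, N (2 * s) ≤ c * (N s + if m Set.univ < ∞ then 1 else 0)

/-- `m(N(f)) ∈ [0, ∞]`. -/
noncomputable def modular (N : ℝ → ℝ) (f : E → ℝ) : ℝ≥0∞ := ∫⁻ x, ENNReal.ofReal (N (f x)) ∂m

/-- `f ∈ L_N(m)`. -/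
def MemOrlicz (N : ℝ → ℝ) (f : E → ℝ) : Prop :=
  AEStronglyMeasurable f m ∧ ∃ α : ℝ, 0 < α ∧ modular m N (fun x => α * f x) < ∞

/-- The Luxemburg norm `‖f‖_{L_N}`. -/
noncomputable def orliczNorm (N : ℝ → ℝ) (f : E → ℝ) : ℝ :=
  sInf {l : ℝ | 0 < l ∧ modular m N (fun x => f x / l) ≤ 1}

/-- `A` is a dense subset of `L_N(m)`. -/
def IsDenseInOrlicz (N : ℝ → ℝ) (A : Set (E → ℝ)) : Prop :=
  A ⊆ {f | MemOrlicz m N f} ∧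
    ∀ f : E → ℝ, MemOrlicz m N f → ∀ ε : ℝ, 0 < ε → ∃ u ∈ A, orliczNorm m N (f - u) < ε

variable {m} {S : Lp ℝ 2 m →ₗ.[ℝ] Lp ℝ 2 m} {g : E → ℝ}
  (J : ExtendedSpace S →L[ℝ] Lp ℝ 1 (weighted m g)) (N : ℝ → ℝ)

/-- `ℱ_e ∩ L_M`, as a subset of `ℱ_e`. -/
def interOrlicz (M : ℝ → ℝ) : Set (ExtendedSpace S) := {v | MemOrlicz m M (J v)}

/-- `V = ℱ_e* ∩ L_N`: those `u ∈ L_N` for which `v ↦ m(u v)` is bounded on `ℱ_e ∩ L_{N*}` with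
respect to the norm of `ℱ_e`. -/
def spaceV : Set (E → ℝ) :=
  {u | MemOrlicz m N u ∧ ∃ c : ℝ, 0 < c ∧
    ∀ v ∈ interOrlicz J (youngDual N), ∫ x, u x * J v x ∂m ≤ c * ‖v‖}

/-- `V` as a subset of `ℱ_e*`: `u ∈ V` is identified with the bounded functional on `ℱ_e` that is
`v ↦ m(u v)` on `ℱ_e ∩ L_{N*}`. -/
def spaceVInDual : Set (StrongDual ℝ (ExtendedSpace S)) :=
  {l | ∃ u ∈ spaceV J N, ∀ v ∈ interOrlicz J (youngDual N), l v = ∫ x, u x * J v x ∂m}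

/-- Condition (N1): `ℱ_e ∩ L_{N*}` is dense in `ℱ_e` and in `L_{N*}`. -/
def ConditionN1 : Prop :=
  Dense (interOrlicz J (youngDual N)) ∧
    IsDenseInOrlicz m (youngDual N) {f | ∃ v ∈ interOrlicz J (youngDual N), f = ⇑(J v)}

/-- Condition (N2): `V` is dense in `ℱ_e*` and in `L_N`. -/
def ConditionN2 : Prop :=
  Dense (spaceVInDual J N) ∧ IsDenseInOrlicz m N (spaceV J N)

end Orlicz

/-! The resolvent is used through its weak equation ℰ(w, G_α f) + α (w, G_α f) = (w, f)
(`exists_of_resolvent`), and S = S* keeps weak limits of form-bounded sequences in the form domain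
(`exists_of_tendsto_inner`). No spectral calculus is needed.

(L1): take an integrable f with 0 < f ≤ 1 and damp it by its potential, g = f / (1 + Gf). Positivity
of the resolvent gives ∫ g G_α g ≤ ∫ g Gf ≤ ∫ f, and Cauchy–Schwarz for ℰ + α(·,·) turns this finite
energy into (v, g) ≤ C ‖v‖ (`exists_reference`). Applied to |v|, this bounds the L¹(g·m) norm, so
the inclusion extends to a bounded map J on ℱ_e. Injectivity of J is the delicate point. If Jξ = 0,
then ξ is annihilated by every functional v ↦ ∫ u Jv dm with |u| ≤ k g. For |f| ≤ k g, functionals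
of this kind, uniformly bounded on ℱ_e, converge to the pairing with G_1 f
(`inner_eq_zero_of_extension`), so ξ is orthogonal to all these G_1 f. Symmetry of the resolvent and
Ker L = 0 then force ξ = 0 (`extended_eq_zero_of_inner_resolvent`).

(N1): bounded integrable functions lie in every Orlicz space. Cutting elements of D(ℰ) between the
heights 1/(n+1) and n+1 makes them bounded and integrable at bounded energy, which gives density in
ℱ_e. For L_{N*}, both the target and its approximants from D(ℰ) are clipped at bounded integrable
φ_n ∈ D(ℰ) with φ_n → ∞; dominated convergence of modulars, available by Δ₂-regularity, does the
rest.

(N2): functions dominated by a multiple of g lie in V, because g ∈ L¹ ∩ L^∞ and their pairing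
factors through J. Clipping at n g gives density in L_N. In ℱ_e*, by Riesz, an element orthogonal to
all of them satisfies Jξ = 0, hence vanishes. -/

section HilbertSpace

variable {H : Type*} [NormedAddCommGroup H] [InnerProductSpace ℝ H]

/-- Weak convergence of a bounded sequence may be tested on a dense set. -/
theorem tendsto_inner_of_dense {a : ℕ → H} {b : H} {C : ℝ} (ha : ∀ n, ‖a n‖ ≤ C) {K : Set H}
    (hK : Dense K) (h : ∀ y ∈ K, Tendsto (fun n => ⟪a n, y⟫_ℝ) atTop (𝓝 ⟪b, y⟫_ℝ)) (y : H) :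
    Tendsto (fun n => ⟪a n, y⟫_ℝ) atTop (𝓝 ⟪b, y⟫_ℝ) := by
  have hC : 0 ≤ C := (norm_nonneg _).trans (ha 0)
  have hD : 0 < C + ‖b‖ + 1 := by positivity
  rw [Metric.tendsto_atTop]
  intro ε hε
  obtain ⟨z, hz, hyz⟩ := hK.exists_dist_lt y (ε := ε / 2 / (C + ‖b‖ + 1)) (by positivity)
  obtain ⟨n₀, hn₀⟩ := Metric.tendsto_atTop.1 (h z hz) (ε / 2) (by positivity)
  refine ⟨n₀, fun n hn => ?_⟩
  have h1 := hn₀ n hn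
  rw [Real.dist_eq] at h1 ⊢
  have e : ⟪a n, y⟫_ℝ - ⟪b, y⟫_ℝ = (⟪a n, z⟫_ℝ - ⟪b, z⟫_ℝ) + ⟪a n - b, y - z⟫_ℝ := by
    simp only [inner_sub_left, inner_sub_right]; ring
  have h2 : |⟪a n - b, y - z⟫_ℝ| ≤ (C + ‖b‖ + 1) * (ε / 2 / (C + ‖b‖ + 1)) := by
    refine (abs_real_inner_le_norm _ _).trans ?_
    refine mul_le_mul ?_ (by rw [← dist_eq_norm]; exact hyz.le) (norm_nonneg _) hD.le
    linarith [norm_sub_le (a n) b, ha n]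
  rw [mul_div_cancel₀ _ hD.ne'] at h2
  rw [e]
  exact (abs_add_le _ _).trans_lt (by linarith)

/-! ### The form of a self-adjoint square root, its completion and the resolvent -/

namespace FormDomain

variable {S : H →ₗ.[ℝ] H}

theorem graph_mem (u : FormDomain S) : (incl S u, op S u) ∈ S.graph :=
  S.mem_graph u

theorem exists_of_mem_graph {x y : H} (h : (x, y) ∈ S.graph) :
    ∃ u : FormDomain S, incl S u = x ∧ op S u = y := by
  obtain ⟨u, h1, h2⟩ := (LinearPMap.mem_graph_iff S).1 h
  exact ⟨u, h1, h2⟩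

theorem inner_def (u v : FormDomain S) : ⟪u, v⟫_ℝ = ⟪op S u, op S v⟫_ℝ := rfl

theorem norm_def (u : FormDomain S) : ‖u‖ = ‖op S u‖ := rfl

theorem incl_injective : Function.Injective (incl S) := Subtype.val_injective

theorem mem_range_incl {x : H} : x ∈ LinearMap.range (incl S) ↔ x ∈ S.domain := by
  constructor
  · rintro ⟨u, rfl⟩
    exact Subtype.property (p := (· ∈ S.domain)) u
  · intro h
    exact ⟨(⟨x, h⟩ : S.domain), rfl⟩

variable [CompleteSpace H]

theorem dense_range_incl (hS : IsSelfAdjoint S) : Dense (Set.range (incl S)) := by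
  convert hS.dense_domain using 1
  ext x
  exact mem_range_incl

theorem inner_op_incl (hS : IsSelfAdjoint S) (u v : FormDomain S) :
    ⟪op S u, incl S v⟫_ℝ = ⟪incl S u, op S v⟫_ℝ := by
  have h := LinearPMap.adjoint_isFormalAdjoint hS.dense_domain
  rw [LinearPMap.isSelfAdjoint_def.1 hS] at h
  exact h u v

/-- A weak limit in `H` of a sequence bounded for the form norm lies in the form domain. -/
theorem exists_of_tendsto_inner (hS : IsSelfAdjoint S) {u : ℕ → FormDomain S} {C : ℝ}
    (hu : ∀ n, ‖u n‖ ≤ C) {x : H}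
    (h : ∀ y, Tendsto (fun n => ⟪incl S (u n), y⟫_ℝ) atTop (𝓝 ⟪x, y⟫_ℝ)) :
    ∃ w : FormDomain S, incl S w = x ∧ ‖w‖ ≤ C ∧
      ∀ y, Tendsto (fun n => ⟪op S (u n), y⟫_ℝ) atTop (𝓝 ⟪op S w, y⟫_ℝ) := by
  have hC : 0 ≤ C := (norm_nonneg _).trans (hu 0)
  have key : ∀ v : FormDomain S,
      Tendsto (fun n => ⟪op S (u n), incl S v⟫_ℝ) atTop (𝓝 ⟪x, op S v⟫_ℝ) := fun v => by
    simpa only [inner_op_incl hS] using h (op S v)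
  have bound : ∀ v : FormDomain S, |⟪x, op S v⟫_ℝ| ≤ C * ‖incl S v‖ := fun v =>
    le_of_tendsto (key v).abs (Eventually.of_forall fun n =>
      (abs_real_inner_le_norm _ _).trans (mul_le_mul_of_nonneg_right (hu n) (norm_nonneg _)))
  -- By `bound`, v ↦ ⟪x, S v⟫ is continuous for the ambient norm, which is membership in D(S*) =
  -- D(S).
  have hx : x ∈ S.adjoint.domain := by
    rw [LinearPMap.mem_adjoint_domain_iff]
    exact AddMonoidHomClass.continuous_of_bound ((innerₛₗ ℝ x).comp S.toFun) C bound
  rw [LinearPMap.isSelfAdjoint_def.1 hS] at hx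
  obtain ⟨w, rfl⟩ := mem_range_incl.2 hx
  have hw : ∀ y, Tendsto (fun n => ⟪op S (u n), y⟫_ℝ) atTop (𝓝 ⟪op S w, y⟫_ℝ) := by
    refine tendsto_inner_of_dense hu (dense_range_incl hS) ?_
    rintro _ ⟨v, rfl⟩
    simpa only [inner_op_incl hS w v] using key v
  refine ⟨w, rfl, ?_, hw⟩
  have h1 : |⟪op S w, op S w⟫_ℝ| ≤ C * ‖op S w‖ :=
    le_of_tendsto (hw _).abs (Eventually.of_forall fun n =>
      (abs_real_inner_le_norm _ _).trans (mul_le_mul_of_nonneg_right (hu n) (norm_nonneg _)))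
  rw [real_inner_self_eq_norm_sq, abs_of_nonneg (by positivity), pow_two] at h1
  rw [norm_def]
  by_contra! h2
  nlinarith

variable (S) in
/-- The isometric extension of `S` to the completion of its domain. -/
noncomputable def extendedOp : ExtendedSpace S →L[ℝ] H :=
  (op S).extendOfNorm (UniformSpace.Completion.toComplL (𝕜 := ℝ) (E := FormDomain S)).toLinearMap

theorem extendedOp_coe (u : FormDomain S) : extendedOp S (u : ExtendedSpace S) = op S u :=
  LinearMap.extendOfNorm_eq UniformSpace.Completion.denseRange_coe
    ⟨1, fun x => by
      rw [one_mul]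
      exact (UniformSpace.Completion.norm_coe x).ge⟩ u

theorem inner_extendedOp (ξ η : ExtendedSpace S) :
    ⟪extendedOp S ξ, extendedOp S η⟫_ℝ = ⟪ξ, η⟫_ℝ := by
  induction ξ, η using UniformSpace.Completion.induction_on₂ with
  | hp =>
    exact isClosed_eq (((extendedOp S).continuous.comp continuous_fst).inner
      ((extendedOp S).continuous.comp continuous_snd)) (continuous_fst.inner continuous_snd)
  | ih u v => rw [extendedOp_coe, extendedOp_coe, UniformSpace.Completion.inner_coe, inner_def]

theorem inner_coe_extended (u : FormDomain S) (η : ExtendedSpace S) :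
    ⟪(u : ExtendedSpace S), η⟫_ℝ = ⟪op S u, extendedOp S η⟫_ℝ := by
  rw [← inner_extendedOp, extendedOp_coe]

/-- An element ξ of the completion orthogonal to `W` is tested through η = `extendedOp S ξ`, so
density in `ExtendedSpace S` becomes a question about vectors of `H`, where weak limits are
available. -/
theorem dense_coe_of_inner_eq_zero {W : Submodule ℝ (FormDomain S)}
    (h : ∀ η : H, (∀ w ∈ W, ⟪op S w, η⟫_ℝ = 0) → ∀ u, ⟪op S u, η⟫_ℝ = 0) :
    Dense ((fun u : FormDomain S => (u : ExtendedSpace S)) '' W) := by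
  let K : Submodule ℝ (ExtendedSpace S) :=
    W.map (UniformSpace.Completion.toComplL (𝕜 := ℝ) (E := FormDomain S)).toLinearMap
  have hK : Kᗮ = ⊥ := by
    rw [Submodule.eq_bot_iff]
    intro ξ hξ
    have h1 : ∀ u : FormDomain S, ⟪(u : ExtendedSpace S), ξ⟫_ℝ = 0 := fun u => by
      rw [inner_coe_extended]
      refine h _ (fun w hw => ?_) u
      rw [← inner_coe_extended]
      exact (Submodule.mem_orthogonal _ _).1 hξ _ (Submodule.mem_map_of_mem hw)
    have h2 : ∀ η : ExtendedSpace S, ⟪η, ξ⟫_ℝ = 0 := fun η => by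
      induction η using UniformSpace.Completion.induction_on with
      | hp => exact isClosed_eq (continuous_id.inner continuous_const) continuous_const
      | ih u => exact h1 u
    exact inner_self_eq_zero.1 (h2 ξ)
  have := Submodule.dense_iff_topologicalClosure_eq_top.2
    (Submodule.topologicalClosure_eq_top_iff.2 hK)
  rwa [Submodule.map_coe] at this

variable {L : H →ₗ.[ℝ] H}

theorem exists_of_mem_graph_neg_sq (hS : IsSqrtNeg L S) {x y : H} (h : (x, y) ∈ L.graph) :
    ∃ v z : FormDomain S, incl S v = x ∧ incl S z = op S v ∧ op S z = -y := by
  obtain ⟨w, h1, h2⟩ := (hS.sq x y).1 h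
  obtain ⟨v, rfl, rfl⟩ := exists_of_mem_graph h1
  obtain ⟨z, hz, h3⟩ := exists_of_mem_graph h2
  exact ⟨v, z, rfl, hz, h3⟩

/-- The weak formulation of the resolvent equation. -/
theorem exists_of_resolvent (hS : IsSqrtNeg L S) {α : ℝ} {f x : H}
    (h : (x, α • x - f) ∈ L.graph) :
    ∃ v : FormDomain S, incl S v = x ∧
      ∀ w : FormDomain S, ⟪w, v⟫_ℝ = ⟪incl S w, f⟫_ℝ - α * ⟪incl S w, x⟫_ℝ := by
  obtain ⟨v, z, hv, hz, h1⟩ := exists_of_mem_graph_neg_sq hS h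
  refine ⟨v, hv, fun w => ?_⟩
  rw [inner_def, ← hz, inner_op_incl hS.selfAdjoint, h1, neg_sub, inner_sub_right,
    inner_smul_right]

theorem norm_resolvent_le (hS : IsSqrtNeg L S) {f x : H} (h : (x, x - f) ∈ L.graph) :
    ‖x‖ ≤ ‖f‖ := by
  obtain ⟨v, rfl, hv⟩ := exists_of_resolvent hS (α := 1) (by rwa [one_smul])
  have h1 := hv v
  rw [real_inner_self_eq_norm_sq, real_inner_self_eq_norm_sq] at h1
  have h2 := real_inner_le_norm (incl S v) f
  by_contra! h3
  nlinarith [sq_nonneg ‖v‖, norm_nonneg (incl S v), norm_nonneg f]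

/-- If `1 - L` has dense range, then it is onto. -/
theorem exists_resolvent_of_dense (hL : IsSelfAdjoint L) (hS : IsSqrtNeg L S) {K : Set H}
    (hK : Dense K) (h : ∀ f ∈ K, ∃ x, (x, x - f) ∈ L.graph) (f : H) :
    ∃ x, (x, x - f) ∈ L.graph := by
  obtain ⟨F, hF, hlim⟩ := mem_closure_iff_seq_limit.1 (hK f)
  choose x hx using fun n => h (F n) (hF n)
  have hcau : CauchySeq x := by
    refine Metric.cauchySeq_iff.2 fun ε hε => ?_
    obtain ⟨N, hN⟩ := Metric.cauchySeq_iff.1 hlim.cauchySeq ε hε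
    refine ⟨N, fun a ha b hb => lt_of_le_of_lt ?_ (hN a ha b hb)⟩
    rw [dist_eq_norm, dist_eq_norm]
    -- Contractivity on differences makes the solutions Cauchy; closedness of the graph then passes
    -- to the limit.
    refine norm_resolvent_le hS ?_
    convert L.graph.sub_mem (hx a) (hx b) using 1
    rw [Prod.mk_sub_mk]
    congr 1
    abel
  obtain ⟨y, hy⟩ := cauchySeq_tendsto_of_complete hcau
  refine ⟨y, ?_⟩
  have hcl : IsClosed (L.graph : Set (H × H)) := hL.isClosed
  exact hcl.mem_of_tendsto (hy.prodMk_nhds (hy.sub hlim)) (Eventually.of_forall hx)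

/-- The energy of a potential bounds the pairing with it. -/
theorem inner_le_of_resolvent_bound (hS : IsSqrtNeg L S) {h : H} {α : ℕ → ℝ} {r : ℕ → H}
    (hα : ∀ n, 0 ≤ α n) (hlim : Tendsto α atTop (𝓝 0))
    (hr : ∀ n, (r n, α n • r n - h) ∈ L.graph) {C : ℝ} (hC : 0 ≤ C)
    (hb : ∀ n, ⟪h, r n⟫_ℝ ≤ C ^ 2) (v : FormDomain S) : ⟪incl S v, h⟫_ℝ ≤ C * ‖v‖ := by
  -- Cauchy–Schwarz for ℰ + α(·,·): the pairing with `h` is this form evaluated at `v` and `r n`,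
  -- and the energy of `r n` is ⟪h, r n⟫ ≤ C².
  have key : ∀ n, ⟪incl S v, h⟫_ℝ ^ 2 ≤ (‖v‖ ^ 2 + α n * ‖incl S v‖ ^ 2) * C ^ 2 := fun n => by
    obtain ⟨u, hu, h1⟩ := exists_of_resolvent hS (hr n)
    have e1 : ⟪incl S v, h⟫_ℝ = ⟪v, u⟫_ℝ + α n * ⟪incl S v, incl S u⟫_ℝ := by
      rw [h1 v, hu]; ring
    have e2 : ⟪h, r n⟫_ℝ = ‖u‖ ^ 2 + α n * ‖incl S u‖ ^ 2 := by
      rw [← real_inner_self_eq_norm_sq, ← real_inner_self_eq_norm_sq, h1 u, hu, real_inner_comm]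
      ring
    have b := hb n
    rw [e2] at b
    refine le_trans ?_ (mul_le_mul_of_nonneg_left b
      (add_nonneg (sq_nonneg _) (mul_nonneg (hα n) (sq_nonneg _))))
    have c1 := abs_real_inner_le_norm v u
    have c2 := abs_real_inner_le_norm (incl S v) (incl S u)
    have c3 : |⟪incl S v, h⟫_ℝ| ≤ ‖v‖ * ‖u‖ + α n * (‖incl S v‖ * ‖incl S u‖) := by
      rw [e1]
      refine (abs_add_le _ _).trans (add_le_add c1 ?_)
      rw [abs_mul, abs_of_nonneg (hα n)]
      exact mul_le_mul_of_nonneg_left c2 (hα n)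
    have c4 := pow_le_pow_left₀ (abs_nonneg _) c3 2
    rw [sq_abs] at c4
    refine c4.trans ?_
    nlinarith [mul_nonneg (hα n) (sq_nonneg (‖v‖ * ‖incl S u‖ - ‖incl S v‖ * ‖u‖))]
  have h2 : Tendsto (fun n => (‖v‖ ^ 2 + α n * ‖incl S v‖ ^ 2) * C ^ 2) atTop
      (𝓝 ((‖v‖ ^ 2 + 0 * ‖incl S v‖ ^ 2) * C ^ 2)) :=
    ((hlim.mul_const _).const_add _).mul_const _
  have h3 := ge_of_tendsto' h2 key
  refine abs_le_of_sq_le_sq' ?_ (by positivity) |>.2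
  calc _ ≤ _ := h3
    _ = _ := by ring

/-- `S` is injective if `L` is. -/
theorem eq_zero_of_op_eq_zero (hS : IsSqrtNeg L S) (hker : ∀ u : L.domain, L u = 0 → u = 0)
    {v : FormDomain S} (h : op S v = 0) : v = 0 := by
  have h1 : (incl S v, (0 : H)) ∈ L.graph :=
    (hS.sq _ _).2 ⟨0, h ▸ graph_mem v, by rw [neg_zero]; exact S.graph.zero_mem⟩
  obtain ⟨x, hx, h2⟩ := (LinearPMap.mem_graph_iff L).1 h1
  apply incl_injective
  rw [map_zero]
  change (x : H) = incl S v at hx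
  rw [← hx, hker x h2]
  rfl

/-- A criterion for an element of the extended space to vanish. -/
theorem extended_eq_zero_of_inner_resolvent (hL : IsSelfAdjoint L) (hS : IsSqrtNeg L S)
    (hker : ∀ u : L.domain, L u = 0 → u = 0) {K : Submodule ℝ H} (hK : Kᗮ = ⊥)
    (hres : ∀ f ∈ K, ∃ x, (x, x - f) ∈ L.graph) {ξ : ExtendedSpace S}
    (hξ : ∀ f ∈ K, ∀ v : FormDomain S, (incl S v, incl S v - f) ∈ L.graph →
      (∀ w : FormDomain S, ⟪w, v⟫_ℝ = ⟪incl S w, f - incl S v⟫_ℝ) →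
      ⟪(v : ExtendedSpace S), ξ⟫_ℝ = 0) : ξ = 0 := by
  have hd : Dense (K : Set H) := Submodule.dense_iff_topologicalClosure_eq_top.2
    (Submodule.topologicalClosure_eq_top_iff.2 hK)
  obtain ⟨p, hp⟩ := exists_resolvent_of_dense hL hS hd hres (extendedOp S ξ)
  obtain ⟨vp, zp, rfl, hz, h1⟩ := exists_of_mem_graph_neg_sq hS hp
  rw [neg_sub] at h1
  -- With p = G_1 η and η = `extendedOp S ξ`, symmetry gives ⟪S G_1 f, η⟫ = ⟪f, S p⟫, and the left
  -- side vanishes by `hξ`. Here `zp` is S p as an element of the form domain, with S(S p) = η - p.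
  have h2 : op S vp ∈ Kᗮ := by
    refine (Submodule.mem_orthogonal _ _).2 fun f hf => ?_
    obtain ⟨x, hx⟩ := hres f hf
    obtain ⟨v, rfl, hv⟩ := exists_of_resolvent hS (α := 1) (f := f) (x := x) (by rwa [one_smul])
    have h3 := hξ f hf v hx fun w => by rw [hv w, one_mul, inner_sub_right]
    have e : extendedOp S ξ = op S zp + incl S vp := by rw [h1]; abel
    have h4 := hv zp
    rw [inner_def, one_mul, hz, real_inner_comm f, real_inner_comm, real_inner_comm (op S vp)] at h4
    rw [inner_coe_extended, e, inner_add_right, inner_op_incl hS.selfAdjoint v vp, h4] at h3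
    rw [real_inner_comm, real_inner_comm (incl S v)] at h3
    linarith [real_inner_comm f (op S vp), real_inner_comm (incl S v) (op S vp)]
  rw [hK, Submodule.mem_bot] at h2
  have h3 := eq_zero_of_op_eq_zero hS hker h2
  rw [h3, map_zero] at hz
  have h4 : zp = 0 := incl_injective (by rw [hz, map_zero])
  rw [h4, map_zero, h3, map_zero, sub_zero] at h1
  have h5 : ⟪ξ, ξ⟫_ℝ = 0 := by rw [← inner_extendedOp, ← h1, inner_zero_left]
  exact inner_self_eq_zero.1 h5

end FormDomain

end HilbertSpace

/-! ### Order and weak convergence in L² -/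

section L2

variable {E : Type*} [MeasurableSpace E] {m : Measure E}

theorem integrable_mul_L2 (f g : Lp ℝ 2 m) : Integrable (fun x => f x * g x) m := by
  simpa [mul_comm] using L2.integrable_inner (𝕜 := ℝ) f g

theorem inner_L2_eq_integral (f g : Lp ℝ 2 m) : ⟪f, g⟫_ℝ = ∫ x, f x * g x ∂m := by
  rw [L2.inner_def]
  simp [mul_comm]

theorem inner_L2_mono {c a b : Lp ℝ 2 m} (hc : 0 ≤ c) (hab : a ≤ b) : ⟪c, a⟫_ℝ ≤ ⟪c, b⟫_ℝ := by
  rw [inner_L2_eq_integral, inner_L2_eq_integral]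
  refine integral_mono_ae (integrable_mul_L2 _ _) (integrable_mul_L2 _ _) ?_
  filter_upwards [(Lp.coeFn_nonneg c).2 hc, (Lp.coeFn_le a b).2 hab] with x h1 h2
  exact mul_le_mul_of_nonneg_left h2 h1

theorem inner_L2_nonneg {c a : Lp ℝ 2 m} (hc : 0 ≤ c) (ha : 0 ≤ a) : 0 ≤ ⟪c, a⟫_ℝ := by
  simpa using inner_L2_mono hc ha

theorem abs_inner_L2_le {u f h : Lp ℝ 2 m} (hf : |f| ≤ h) : |⟪u, f⟫_ℝ| ≤ ⟪|u|, h⟫_ℝ := by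
  rw [inner_L2_eq_integral, inner_L2_eq_integral]
  refine abs_integral_le_integral_abs.trans ?_
  refine integral_mono_ae (integrable_mul_L2 _ _).abs (integrable_mul_L2 _ _) ?_
  filter_upwards [Lp.coeFn_abs u, Lp.coeFn_abs f, (Lp.coeFn_le _ _).2 hf] with x h1 h2 h3
  rw [h1, abs_mul]
  exact mul_le_mul_of_nonneg_left (h2 ▸ h3) (abs_nonneg _)

/-- Dominated convergence in `L²`, weak form. -/
theorem tendsto_inner_L2_of_ae {F : ℕ → Lp ℝ 2 m} {f G : Lp ℝ 2 m}
    (hb : ∀ n, ∀ᵐ x ∂m, |F n x| ≤ |G x|)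
    (hlim : ∀ᵐ x ∂m, Tendsto (fun n => F n x) atTop (𝓝 (f x))) (y : Lp ℝ 2 m) :
    Tendsto (fun n => ⟪F n, y⟫_ℝ) atTop (𝓝 ⟪f, y⟫_ℝ) := by
  simp only [inner_L2_eq_integral]
  refine tendsto_integral_of_dominated_convergence (fun x => |G x * y x|)
    (fun n => (integrable_mul_L2 _ _).aestronglyMeasurable) (integrable_mul_L2 _ _).abs
    (fun n => ?_) ?_
  · filter_upwards [hb n] with x hx
    rw [Real.norm_eq_abs, abs_mul, abs_mul]
    exact mul_le_mul_of_nonneg_right hx (abs_nonneg _)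
  · filter_upwards [hlim] with x hx
    exact hx.mul_const _

/-- A dense subset of `L²` contains sequences converging almost everywhere to a given function. -/
theorem exists_seq_ae_tendsto_of_dense {K : Set (Lp ℝ 2 m)} (hK : Dense K) (f : Lp ℝ 2 m) :
    ∃ F : ℕ → Lp ℝ 2 m, (∀ n, F n ∈ K) ∧
      ∀ᵐ x ∂m, Tendsto (fun n => F n x) atTop (𝓝 (f x)) := by
  obtain ⟨F, hF, hlim⟩ := mem_closure_iff_seq_limit.1 (hK f)
  obtain ⟨ns, -, h⟩ := (tendstoInMeasure_of_tendsto_Lp hlim).exists_seq_tendsto_ae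
  exact ⟨fun n => F (ns n), fun n => hF _, h⟩

end L2

/-! ### Truncations -/

/-- The part of `t` between the heights `1 / (n + 1)` and `n + 1`. -/
noncomputable def slab (n : ℕ) (t : ℝ) : ℝ :=
  min (max t 0) ((n : ℝ) + 1) - min (max t 0) (1 / ((n : ℝ) + 1))

theorem one_div_succ_le (n : ℕ) : 1 / ((n : ℝ) + 1) ≤ (n : ℝ) + 1 := by
  have h : (1 : ℝ) ≤ (n : ℝ) + 1 := by linarith [n.cast_nonneg (α := ℝ)]
  exact ((div_le_one (by linarith)).2 h).trans h

theorem slab_nonneg (n : ℕ) (t : ℝ) : 0 ≤ slab n t :=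
  sub_nonneg.2 (min_le_min_left _ (one_div_succ_le n))

theorem slab_le (n : ℕ) (t : ℝ) : slab n t ≤ (n : ℝ) + 1 := by
  have h : 0 ≤ min (max t 0) (1 / ((n : ℝ) + 1)) := le_min (le_max_right _ _) (by positivity)
  rw [slab]
  linarith [min_le_right (max t 0) ((n : ℝ) + 1)]

theorem slab_le_abs (n : ℕ) (t : ℝ) : slab n t ≤ |t| := by
  have h : 0 ≤ min (max t 0) (1 / ((n : ℝ) + 1)) := le_min (le_max_right _ _) (by positivity)
  rw [slab]
  linarith [min_le_left (max t 0) ((n : ℝ) + 1), max_le (le_abs_self t) (abs_nonneg t)]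

/-- The slab vanishes for t ≤ 1/(n+1), and above this height t ≤ (n+1) t². This is what makes slabs
of L² functions integrable. -/
theorem slab_le_sq (n : ℕ) (t : ℝ) : slab n t ≤ ((n : ℝ) + 1) * t ^ 2 := by
  rcases le_total (max t 0) (1 / ((n : ℝ) + 1)) with h | h
  · rw [slab, min_eq_left h, min_eq_left (h.trans (one_div_succ_le n)), sub_self]
    positivity
  · have hp : 0 < 1 / ((n : ℝ) + 1) := by positivity
    have ht : 0 < t := by
      by_contra! h'
      rw [max_eq_right h'] at h
      linarith
    rw [max_eq_left ht.le, div_le_iff₀ (by positivity)] at h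
    have h2 := slab_le_abs n t
    rw [abs_of_pos ht] at h2
    nlinarith

theorem tendsto_slab {t : ℕ → ℝ} {s : ℝ} (h : Tendsto t atTop (𝓝 s)) :
    Tendsto (fun n => slab n (t n)) atTop (𝓝 (max s 0)) := by
  have h0 : Tendsto (fun n => max (t n) 0) atTop (𝓝 (max s 0)) := h.max tendsto_const_nhds
  have h1 : Tendsto (fun n : ℕ => min (max (t n) 0) ((n : ℝ) + 1)) atTop (𝓝 (max s 0)) := by
    refine h0.congr' ?_
    have hN : ∀ᶠ n : ℕ in atTop, max s 0 + 1 ≤ (n : ℝ) :=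
      tendsto_natCast_atTop_atTop.eventually_ge_atTop _
    filter_upwards [h0.eventually_lt_const (lt_add_one _), hN] with n h2 h3
    rw [min_eq_left (by linarith)]
  have h2 : Tendsto (fun n : ℕ => min (max (t n) 0) (1 / ((n : ℝ) + 1))) atTop (𝓝 0) :=
    squeeze_zero (fun n => le_min (le_max_right _ _) (by positivity)) (fun n => min_le_right _ _)
      tendsto_one_div_add_atTop_nhds_zero_nat
  simpa [slab] using h1.sub h2

/-! ### Lattice operations on the form domain and positivity of the resolvent -/

namespace FormDomain

section Lattice

variable {E : Type*} [MeasurableSpace E] {m : Measure E} {S : Lp ℝ 2 m →ₗ.[ℝ] Lp ℝ 2 m}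

theorem exists_truncation (hM : IsMarkovian m S) {c : ℝ} (hc : 0 < c) (u : FormDomain S) :
    ∃ v : FormDomain S, (⇑(incl S v) =ᵐ[m] fun x => min (max (incl S u x) 0) c) ∧ ‖v‖ ≤ ‖u‖ := by
  obtain ⟨v, hv, hle⟩ := hM (c⁻¹ • u)
  rw [real_inner_self_eq_norm_sq, real_inner_self_eq_norm_sq] at hle
  have hle' : ‖v‖ ≤ ‖c⁻¹ • u‖ := abs_le_of_sq_le_sq' hle (norm_nonneg _) |>.2
  refine ⟨c • v, ?_, ?_⟩
  · rw [map_smul]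
    rw [map_smul] at hv
    filter_upwards [hv, Lp.coeFn_smul c (incl S v), Lp.coeFn_smul c⁻¹ (incl S u)] with x h1 h2 h3
    rw [h2, Pi.smul_apply, h1, h3, Pi.smul_apply, smul_eq_mul, smul_eq_mul,
      mul_min_of_nonneg _ _ hc.le, mul_max_of_nonneg _ _ hc.le, mul_inv_cancel_left₀ hc.ne',
      mul_zero, mul_one]
  · rw [norm_smul] at hle' ⊢
    rw [norm_inv, ← div_eq_inv_mul, le_div_iff₀ (norm_pos_iff.2 hc.ne')] at hle'
    linarith

/-- The truncations at the heights n + 1 do not increase the energy and converge weakly in L² to the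
positive part, so `exists_of_tendsto_inner` applies. -/
theorem exists_sup_zero (hS : IsSelfAdjoint S) (hM : IsMarkovian m S) (u : FormDomain S) :
    ∃ v : FormDomain S, incl S v = incl S u ⊔ 0 ∧ ‖v‖ ≤ ‖u‖ := by
  choose v hv hle using fun n : ℕ => exists_truncation hM (c := (n : ℝ) + 1) (by positivity) u
  suffices h : ∀ y, Tendsto (fun n => ⟪incl S (v n), y⟫_ℝ) atTop (𝓝 ⟪incl S u ⊔ 0, y⟫_ℝ) by
    obtain ⟨w, hw, hle', -⟩ := exists_of_tendsto_inner hS hle h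
    exact ⟨w, hw, hle'⟩
  refine tendsto_inner_L2_of_ae (G := incl S u) (fun n => ?_) ?_
  · filter_upwards [hv n] with x hx
    rw [hx, abs_of_nonneg (le_min (le_max_right _ _) (by positivity))]
    exact (min_le_left _ _).trans (max_le (le_abs_self _) (abs_nonneg _))
  · filter_upwards [ae_all_iff.2 hv, Lp.coeFn_sup (incl S u) 0, Lp.coeFn_zero ℝ 2 m] with x h1 h2 h3
    rw [h2, Pi.sup_apply, h3, Pi.zero_apply]
    refine tendsto_const_nhds.congr' ?_
    have hN : ∀ᶠ n : ℕ in atTop, max (incl S u x) 0 ≤ (n : ℝ) :=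
      tendsto_natCast_atTop_atTop.eventually_ge_atTop _
    filter_upwards [hN] with n hn
    rw [h1 n, min_eq_left (by linarith)]

theorem exists_sup (hS : IsSelfAdjoint S) (hM : IsMarkovian m S) (u w : FormDomain S) :
    ∃ v : FormDomain S, incl S v = incl S u ⊔ incl S w := by
  obtain ⟨v, hv, -⟩ := exists_sup_zero hS hM (u - w)
  refine ⟨v + w, ?_⟩
  rw [map_add, hv, map_sub, sup_add, sub_add_cancel, zero_add]

theorem exists_inf (hS : IsSelfAdjoint S) (hM : IsMarkovian m S) (u w : FormDomain S) :
    ∃ v : FormDomain S, incl S v = incl S u ⊓ incl S w := by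
  obtain ⟨v, hv⟩ := exists_sup hS hM (-u) (-w)
  refine ⟨-v, ?_⟩
  rw [map_neg, hv, map_neg, map_neg, neg_sup, neg_neg, neg_neg]

theorem exists_abs (hS : IsSelfAdjoint S) (hM : IsMarkovian m S) (u : FormDomain S) :
    ∃ v : FormDomain S, incl S v = |incl S u| ∧ ‖v‖ ≤ 2 * ‖u‖ := by
  obtain ⟨v, hv, h1⟩ := exists_sup_zero hS hM u
  obtain ⟨w, hw, h2⟩ := exists_sup_zero hS hM (-u)
  refine ⟨v + w, ?_, ?_⟩
  · rw [map_add, hv, hw, map_neg]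
    exact posPart_add_negPart (incl S u)
  · rw [norm_neg] at h2
    linarith [norm_add_le v w]

/-- The resolvent preserves positivity. -/
theorem resolvent_nonneg {L : Lp ℝ 2 m →ₗ.[ℝ] Lp ℝ 2 m} (hS : IsSqrtNeg L S)
    (hM : IsMarkovian m S) {α : ℝ} (hα : 0 < α) {f x : Lp ℝ 2 m} (hf : 0 ≤ f)
    (h : (x, α • x - f) ∈ L.graph) : 0 ≤ x := by
  obtain ⟨v, rfl, hv⟩ := exists_of_resolvent hS h
  obtain ⟨w, hw, hle⟩ := exists_sup_zero hS.selfAdjoint hM v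
  have e1 := hv w
  have e2 := hv v
  rw [real_inner_self_eq_norm_sq] at e2
  have h0 : 0 ≤ ⟪incl S w - incl S v, f⟫_ℝ := by
    rw [hw]
    exact inner_L2_nonneg (sub_nonneg.2 le_sup_left) hf
  have e3 : ⟪incl S v - incl S w, incl S v⟫_ℝ = ‖incl S v - incl S w‖ ^ 2 := by
    rw [← real_inner_self_eq_norm_sq, inner_L2_eq_integral, inner_L2_eq_integral, hw]
    refine integral_congr_ae ?_
    filter_upwards [Lp.coeFn_sub (incl S v) (incl S v ⊔ 0), Lp.coeFn_sup (incl S v) 0,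
      Lp.coeFn_zero ℝ 2 m] with x h1 h2 h3
    rw [h1, Pi.sub_apply, h2, Pi.sup_apply, h3, Pi.zero_apply]
    rcases le_total (incl S v x) 0 with h4 | h4
    · rw [sup_eq_right.2 h4, sub_zero]
    · rw [sup_eq_left.2 h4, sub_self, zero_mul, zero_mul]
  -- With w = v⁺, ‖w‖ ≤ ‖v‖ gives ℰ(w - v, v) ≤ 0, whereas the resolvent equation gives ℰ(w - v, v)
  -- ≥ α ‖v⁻‖². Hence v⁻ = 0.
  have e4 : ‖w - v‖ ^ 2 = ‖w‖ ^ 2 - 2 * ⟪w, v⟫_ℝ + ‖v‖ ^ 2 := norm_sub_sq_real w v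
  have h5 : ‖w‖ ^ 2 ≤ ‖v‖ ^ 2 := pow_le_pow_left₀ (norm_nonneg _) hle 2
  rw [inner_sub_left] at h0 e3
  have h6 : α * ‖incl S v - incl S w‖ ^ 2 ≤ 0 := by
    rw [← e3]
    nlinarith [sq_nonneg ‖w - v‖]
  have h7 : ‖incl S v - incl S w‖ = 0 := by
    by_contra h8
    have : 0 < ‖incl S v - incl S w‖ := lt_of_le_of_ne (norm_nonneg _) (Ne.symm h8)
    have : 0 < α * ‖incl S v - incl S w‖ ^ 2 := by positivity
    linarith
  rw [sub_eq_zero.1 (norm_eq_zero.1 h7), hw]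
  exact le_sup_right

variable (S) in
/-- The bounded integrable functions in the form domain. -/
def boundedIntegrable : Submodule ℝ (FormDomain S) where
  carrier := {u | MemLp (incl S u) 1 m ∧ MemLp (incl S u) ∞ m}
  zero_mem' := by
    have h : ⇑(incl S (0 : FormDomain S)) =ᵐ[m] 0 := by rw [map_zero]; exact Lp.coeFn_zero ℝ 2 m
    exact ⟨MemLp.zero.ae_eq h.symm, MemLp.zero.ae_eq h.symm⟩
  add_mem' := fun {u v} hu hv => by
    have h : ⇑(incl S (u + v)) =ᵐ[m] incl S u + incl S v := by rw [map_add]; exact Lp.coeFn_add _ _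
    exact ⟨(hu.1.add hv.1).ae_eq h.symm, (hu.2.add hv.2).ae_eq h.symm⟩
  smul_mem' := fun c u hu => by
    have h : ⇑(incl S (c • u)) =ᵐ[m] c • ⇑(incl S u) := by rw [map_smul]; exact Lp.coeFn_smul _ _
    exact ⟨(hu.1.const_smul c).ae_eq h.symm, (hu.2.const_smul c).ae_eq h.symm⟩

theorem exists_slab (hM : IsMarkovian m S) (n : ℕ) (u : FormDomain S) :
    ∃ w ∈ boundedIntegrable S, (⇑(incl S w) =ᵐ[m] fun x => slab n (incl S u x)) ∧
      ‖w‖ ≤ 2 * ‖u‖ := by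
  obtain ⟨a, ha, ha'⟩ := exists_truncation hM (c := (n : ℝ) + 1) (by positivity) u
  obtain ⟨b, hb, hb'⟩ := exists_truncation hM (c := 1 / ((n : ℝ) + 1)) (by positivity) u
  have hw : ⇑(incl S (a - b)) =ᵐ[m] fun x => slab n (incl S u x) := by
    rw [map_sub]
    filter_upwards [ha, hb, Lp.coeFn_sub (incl S a) (incl S b)] with x h1 h2 h3
    rw [h3, Pi.sub_apply, h1, h2, slab]
  have hmeas := (Lp.aestronglyMeasurable (incl S (a - b)))
  refine ⟨a - b, ⟨?_, ?_⟩, hw, by linarith [norm_sub_le a b]⟩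
  · rw [memLp_one_iff_integrable]
    refine (((Lp.memLp (incl S u)).integrable_sq).const_mul ((n : ℝ) + 1)).mono' hmeas ?_
    filter_upwards [hw] with x hx
    rw [hx, Real.norm_eq_abs, abs_of_nonneg (slab_nonneg _ _)]
    exact slab_le_sq _ _
  · refine memLp_top_of_bound hmeas ((n : ℝ) + 1) ?_
    filter_upwards [hw] with x hx
    rw [hx, Real.norm_eq_abs, abs_of_nonneg (slab_nonneg _ _)]
    exact slab_le _ _

/-- The slabs of u have energy norm at most 2‖u‖ and tend weakly to u⁺, so their images under S tend
weakly to S u⁺ and orthogonality to all slabs passes to u⁺. The same for -u, and u = u⁺ - u⁻. -/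
theorem dense_coe_boundedIntegrable (hS : IsSelfAdjoint S) (hM : IsMarkovian m S) :
    Dense ((fun u : FormDomain S => (u : ExtendedSpace S)) '' boundedIntegrable S) := by
  refine dense_coe_of_inner_eq_zero fun η hη => ?_
  have key : ∀ u v : FormDomain S, incl S v = incl S u ⊔ 0 → ⟪op S v, η⟫_ℝ = 0 := by
    intro u v hv
    choose w hw hw' hle using fun n : ℕ => exists_slab hM n u
    suffices h : ∀ y, Tendsto (fun n => ⟪incl S (w n), y⟫_ℝ) atTop (𝓝 ⟪incl S u ⊔ 0, y⟫_ℝ) by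
      obtain ⟨v', hv', -, hlim⟩ := exists_of_tendsto_inner hS hle h
      rw [incl_injective (hv.trans hv'.symm)]
      refine tendsto_nhds_unique (hlim η) ?_
      simp only [hη _ (hw _), tendsto_const_nhds_iff]
    refine tendsto_inner_L2_of_ae (G := incl S u) (fun n => ?_) ?_
    · filter_upwards [hw' n] with x hx
      rw [hx, abs_of_nonneg (slab_nonneg _ _)]
      exact slab_le_abs _ _
    · filter_upwards [ae_all_iff.2 hw', Lp.coeFn_sup (incl S u) 0, Lp.coeFn_zero ℝ 2 m]
        with x h1 h2 h3
      rw [h2, Pi.sup_apply, h3, Pi.zero_apply]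
      simp only [h1]
      exact tendsto_slab tendsto_const_nhds
  intro u
  obtain ⟨v, hv, -⟩ := exists_sup_zero hS hM u
  obtain ⟨w, hw, -⟩ := exists_sup_zero hS hM (-u)
  have hu : u = v - w := incl_injective (by
    rw [map_sub, hv, hw, map_neg]
    exact (posPart_sub_negPart (incl S u)).symm)
  rw [hu, map_sub, inner_sub_left, key _ _ hv, key _ _ hw, sub_zero]

end Lattice

end FormDomain

/-! ### Clipping -/

/-- The projection of `t` to `[-c, c]`. -/
noncomputable def clip (c t : ℝ) : ℝ := max (min t c) (-c)

theorem abs_clip_le {c : ℝ} (hc : 0 ≤ c) (t : ℝ) : |clip c t| ≤ c :=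
  abs_le.2 ⟨le_max_right _ _, max_le (min_le_right _ _) (by linarith)⟩

theorem clip_eq_self {c t : ℝ} (h : |t| ≤ c) : clip c t = t := by
  rw [clip, min_eq_left (abs_le.1 h).2, max_eq_left (abs_le.1 h).1]

theorem clip_of_nonneg {c t : ℝ} (hc : 0 ≤ c) (ht : 0 ≤ t) : clip c t = min t c :=
  max_eq_left ((neg_nonpos.2 hc).trans (le_min ht hc))

theorem clip_of_nonpos {c t : ℝ} (hc : 0 ≤ c) (ht : t ≤ 0) : clip c t = max t (-c) := by
  rw [clip, min_eq_left (ht.trans hc)]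

theorem abs_clip_le_abs {c : ℝ} (hc : 0 ≤ c) (t : ℝ) : |clip c t| ≤ |t| := by
  rcases le_total 0 t with ht | ht
  · rw [clip_of_nonneg hc ht, abs_of_nonneg (le_min ht hc), abs_of_nonneg ht]
    exact min_le_left _ _
  · rw [clip_of_nonpos hc ht, abs_of_nonpos (max_le ht (by linarith)), abs_of_nonpos ht]
    linarith [le_max_left t (-c)]

theorem abs_sub_clip_le {c : ℝ} (hc : 0 ≤ c) (t : ℝ) : |t - clip c t| ≤ |t| := by
  rcases le_total 0 t with ht | ht
  · rw [clip_of_nonneg hc ht, abs_of_nonneg (by linarith [min_le_left t c]), abs_of_nonneg ht]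
    linarith [le_min ht hc]
  · rw [clip_of_nonpos hc ht, abs_of_nonpos (by linarith [le_max_left t (-c)]), abs_of_nonpos ht]
    linarith [max_le ht (neg_nonpos.2 hc)]

theorem clip_mul_self_nonneg {c : ℝ} (hc : 0 ≤ c) (t : ℝ) : 0 ≤ clip c t * t := by
  rcases le_total 0 t with ht | ht
  · rw [clip_of_nonneg hc ht]
    exact mul_nonneg (le_min ht hc) ht
  · rw [clip_of_nonpos hc ht]
    exact mul_nonneg_of_nonpos_of_nonpos (max_le ht (by linarith)) ht

theorem eq_zero_of_clip_mul_self {c t : ℝ} (hc : 0 < c) (h : clip c t * t = 0) : t = 0 := by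
  rcases mul_eq_zero.1 h with h | h
  · rcases le_total 0 t with ht | ht
    · rw [clip_of_nonneg hc.le ht] at h
      rcases min_choice t c with h' | h' <;> linarith
    · rw [clip_of_nonpos hc.le ht] at h
      rcases max_choice t (-c) with h' | h' <;> linarith
  · exact h

theorem continuous_clip (c : ℝ) : Continuous (clip c) :=
  (continuous_id.min continuous_const).max continuous_const

/-! ### Functions dominated by a weight, and the weighted L¹ space -/

section Weight

variable {E : Type*} [MeasurableSpace E] {m : Measure E}

theorem coeFn_clip_L2 (γ f : Lp ℝ 2 m) :
    ⇑(f ⊓ γ ⊔ -γ) =ᵐ[m] fun x => clip (γ x) (f x) := by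
  filter_upwards [Lp.coeFn_sup (f ⊓ γ) (-γ), Lp.coeFn_inf f γ, Lp.coeFn_neg γ] with x h1 h2 h3
  rw [h1, Pi.sup_apply, h2, h3]
  rfl

/-- The functions dominated by a multiple of `γ`. -/
def dominatedBy (γ : Lp ℝ 2 m) : Submodule ℝ (Lp ℝ 2 m) where
  carrier := {f | ∃ k : ℝ, 0 ≤ k ∧ |f| ≤ k • γ}
  zero_mem' := ⟨0, le_rfl, by simp⟩
  add_mem' := by
    rintro f g ⟨k, hk, hf⟩ ⟨l, hl, hg⟩
    refine ⟨k + l, add_nonneg hk hl, (abs_add_le f g).trans ?_⟩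
    rw [add_smul]
    exact add_le_add hf hg
  smul_mem' := by
    rintro c f ⟨k, hk, hf⟩
    refine ⟨|c| * k, by positivity, ?_⟩
    rw [← Lp.coeFn_le] at hf ⊢
    filter_upwards [hf, Lp.coeFn_abs f, Lp.coeFn_abs (c • f), Lp.coeFn_smul c f,
      Lp.coeFn_smul k γ, Lp.coeFn_smul (|c| * k) γ] with x h1 h2 h3 h4 h5 h6
    rw [h3, h4, h6, Pi.smul_apply, Pi.smul_apply, smul_eq_mul, smul_eq_mul, abs_mul, mul_assoc]
    rw [h2, h5] at h1
    exact mul_le_mul_of_nonneg_left h1 (abs_nonneg _)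

/-- Test h against its own clip at ±γ: the product is nonnegative and vanishes only where h does. -/
theorem dominatedBy_orthogonal {γ : Lp ℝ 2 m} (hγ : 0 ≤ γ) (hpos : ∀ᵐ x ∂m, 0 < γ x) :
    (dominatedBy γ)ᗮ = ⊥ := by
  rw [Submodule.eq_bot_iff]
  intro h hh
  have h1 : ⟪h ⊓ γ ⊔ -γ, h⟫_ℝ = 0 := by
    refine (Submodule.mem_orthogonal _ _).1 hh _ ⟨1, zero_le_one, ?_⟩
    rw [one_smul]
    exact abs_le'.2 ⟨sup_le inf_le_right ((neg_nonpos.2 hγ).trans hγ), neg_le.2 le_sup_right⟩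
  rw [inner_L2_eq_integral, integral_eq_zero_iff_of_nonneg_ae ?_ (integrable_mul_L2 _ _)] at h1
  · refine Lp.ext ?_
    filter_upwards [h1, coeFn_clip_L2 γ h, hpos, Lp.coeFn_zero ℝ 2 m] with x h2 h3 h4 h5
    rw [h5]
    rw [h3] at h2
    exact eq_zero_of_clip_mul_self h4 h2
  · filter_upwards [coeFn_clip_L2 γ h, hpos] with x h3 h4
    rw [h3]
    exact clip_mul_self_nonneg h4.le _

namespace IsWeight

variable {g : E → ℝ}

theorem aemeasurable_ofReal (hg : IsWeight m g) : AEMeasurable (fun x => ENNReal.ofReal (g x)) m :=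
  hg.memL1.1.aemeasurable.ennreal_ofReal

theorem absolutelyContinuous (hg : IsWeight m g) : m ≪ weighted m g := by
  refine withDensity_absolutelyContinuous' hg.aemeasurable_ofReal ?_
  filter_upwards [hg.pos] with x hx
  simpa using hx

theorem integrable_iff (hg : IsWeight m g) {f : E → ℝ} :
    Integrable f (weighted m g) ↔ Integrable (fun x => g x * f x) m := by
  rw [weighted, integrable_withDensity_iff_integrable_smul₀' hg.aemeasurable_ofReal
    (Eventually.of_forall fun _ => ENNReal.ofReal_lt_top)]
  refine integrable_congr ?_
  filter_upwards [hg.pos] with x hx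
  rw [ENNReal.toReal_ofReal hx.le, smul_eq_mul]

theorem integral_eq (hg : IsWeight m g) (f : E → ℝ) :
    ∫ x, f x ∂(weighted m g) = ∫ x, g x * f x ∂m := by
  rw [weighted, integral_withDensity_eq_integral_toReal_smul₀ hg.aemeasurable_ofReal
    (Eventually.of_forall fun _ => ENNReal.ofReal_lt_top)]
  refine integral_congr_ae ?_
  filter_upwards [hg.pos] with x hx
  rw [ENNReal.toReal_ofReal hx.le, smul_eq_mul]

theorem norm_eq (hg : IsWeight m g) (f : Lp ℝ 1 (weighted m g)) : ‖f‖ = ∫ x, g x * |f x| ∂m := by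
  rw [L1.norm_eq_integral_norm, hg.integral_eq]
  rfl

theorem integrable_mul_abs (hg : IsWeight m g) (f : Lp ℝ 1 (weighted m g)) :
    Integrable (fun x => g x * |f x|) m :=
  hg.integrable_iff.1 (L1.integrable_coeFn f).abs

theorem aestronglyMeasurable_coeFn (hg : IsWeight m g) (f : Lp ℝ 1 (weighted m g)) :
    AEStronglyMeasurable f m :=
  (Lp.aestronglyMeasurable f).mono_ac hg.absolutelyContinuous

theorem integrable_mul (hg : IsWeight m g) {u : E → ℝ} (hu : AEStronglyMeasurable u m) {c : ℝ}
    (hc : ∀ᵐ x ∂m, |u x| ≤ c * g x) (f : Lp ℝ 1 (weighted m g)) :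
    Integrable (fun x => u x * f x) m := by
  refine ((hg.integrable_mul_abs f).const_mul c).mono'
    (hu.mul (hg.aestronglyMeasurable_coeFn f)) ?_
  filter_upwards [hc] with x hx
  rw [Real.norm_eq_abs, abs_mul, ← mul_assoc]
  exact mul_le_mul_of_nonneg_right hx (abs_nonneg _)

/-- Integration against a function dominated by the weight is bounded on `L¹(g · m)`. -/
theorem exists_functional (hg : IsWeight m g) {u : E → ℝ} (hu : AEStronglyMeasurable u m) {c : ℝ}
    (hc : ∀ᵐ x ∂m, |u x| ≤ c * g x) :
    ∃ ℓ : StrongDual ℝ (Lp ℝ 1 (weighted m g)),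
      ∀ f : Lp ℝ 1 (weighted m g), ℓ f = ∫ x, u x * f x ∂m := by
  refine ⟨LinearMap.mkContinuous
    { toFun := fun f => ∫ x, u x * f x ∂m
      map_add' := fun f h => ?_
      map_smul' := fun a f => ?_ } c fun f => ?_, fun f => rfl⟩
  · rw [← integral_add (hg.integrable_mul hu hc f) (hg.integrable_mul hu hc h)]
    refine integral_congr_ae ?_
    filter_upwards [hg.absolutelyContinuous.ae_le (Lp.coeFn_add f h)] with x hx
    rw [hx, Pi.add_apply, mul_add]
  · rw [RingHom.id_apply, smul_eq_mul, ← integral_const_mul]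
    refine integral_congr_ae ?_
    filter_upwards [hg.absolutelyContinuous.ae_le (Lp.coeFn_smul a f)] with x hx
    rw [hx, Pi.smul_apply, smul_eq_mul, mul_left_comm]
  · rw [hg.norm_eq, ← integral_const_mul]
    refine abs_integral_le_integral_abs.trans ?_
    refine integral_mono_ae (hg.integrable_mul hu hc f).abs
      ((hg.integrable_mul_abs f).const_mul c) ?_
    filter_upwards [hc] with x hx
    rw [abs_mul, ← mul_assoc]
    exact mul_le_mul_of_nonneg_right hx (abs_nonneg _)

/-- The functions dominated by the weight separate the points of `L¹(g · m)`. -/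
theorem eq_zero_of_integral_mul (hg : IsWeight m g) {f : Lp ℝ 1 (weighted m g)}
    (h : ∀ u : E → ℝ, AEStronglyMeasurable u m → (∀ᵐ x ∂m, |u x| ≤ g x) →
      ∫ x, u x * f x ∂m = 0) : f = 0 := by
  have hm : AEStronglyMeasurable (fun x => clip (g x) (f x)) m :=
    ((hg.aestronglyMeasurable_coeFn f).inf hg.memL1.1).sup hg.memL1.1.neg
  have hb : ∀ᵐ x ∂m, |clip (g x) (f x)| ≤ g x := by
    filter_upwards [hg.pos] with x hx using abs_clip_le hx.le _
  have h1 := h _ hm hb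
  rw [integral_eq_zero_iff_of_nonneg_ae ?_
    (hg.integrable_mul hm (c := 1) (by simpa using hb) f)] at h1
  · refine Lp.ext ?_
    have h2 : ∀ᵐ x ∂m, f x = 0 := by
      filter_upwards [h1, hg.pos] with x h2 h4 using eq_zero_of_clip_mul_self h4 h2
    have h3 := (withDensity_absolutelyContinuous m fun x => ENNReal.ofReal (g x)).ae_le h2
    filter_upwards [h3, Lp.coeFn_zero ℝ 1 (weighted m g)] with x h4 h5
    rw [h4, h5, Pi.zero_apply]
  · filter_upwards [hg.pos] with x hx using clip_mul_self_nonneg hx.le _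

end IsWeight

end Weight

/-! ### The reference function of a transient form -/

namespace FormDomain

section Transience

variable {E : Type*} [MeasurableSpace E] {m : Measure E} {L S : Lp ℝ 2 m →ₗ.[ℝ] Lp ℝ 2 m}

theorem exists_resolvent_of_integrable (ht : IsTransient m L) {f : Lp ℝ 2 m}
    (hf : Integrable f m) : ∃ x, (x, x - f) ∈ L.graph := by
  have key : ∀ h : Lp ℝ 2 m, Integrable h m → ∃ x, (x, x - h ⊔ 0) ∈ L.graph := fun h hh => by
    have hi : Integrable (h ⊔ 0 : Lp ℝ 2 m) m := by
      refine hh.abs.mono' (Lp.aestronglyMeasurable _) ?_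
      filter_upwards [Lp.coeFn_sup h 0, Lp.coeFn_zero ℝ 2 m] with x h1 h2
      rw [h1, Pi.sup_apply, h2, Pi.zero_apply, Real.norm_eq_abs, abs_of_nonneg le_sup_right]
      exact sup_le (le_abs_self _) (abs_nonneg _)
    obtain ⟨R, hR, -⟩ := ht (h ⊔ 0) le_sup_right hi
    have := hR 0
    -- The index n = 0 corresponds to α = 1.
    rw [IsResolventAt, Nat.cast_zero, zero_add, div_one, one_smul] at this
    exact ⟨R 0, this⟩
  obtain ⟨x, hx⟩ := key f hf
  obtain ⟨y, hy⟩ := key (-f) (hf.neg.congr (Lp.coeFn_neg f).symm)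
  refine ⟨x - y, ?_⟩
  convert L.graph.sub_mem hx hy using 1
  rw [Prod.mk_sub_mk]
  congr 1
  have : f = f ⊔ 0 - (-f) ⊔ 0 := (posPart_sub_negPart f).symm
  nth_rewrite 1 [this]
  abel

/-- A transient Dirichlet space has a reference function. -/
theorem exists_reference [SigmaFinite m] (hS : IsSqrtNeg L S)
    (ht : IsTransientDirichletSpace m L S) :
    ∃ (g : E → ℝ) (γ : Lp ℝ 2 m), IsWeight m g ∧ ⇑γ =ᵐ[m] g ∧
      ∃ C : ℝ, 0 ≤ C ∧ ∀ v : FormDomain S, ⟪incl S v, γ⟫_ℝ ≤ C * ‖v‖ := by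
  obtain ⟨f0, hf0, hf0m, hf0i⟩ := exists_pos_lintegral_lt_of_sigmaFinite m one_ne_zero
  set f : E → ℝ := fun x => min (f0 x : ℝ) 1 with hf_def
  have hfm : Measurable f := hf0m.coe_nnreal_real.min measurable_const
  have hfpos : ∀ x, 0 < f x := fun x => lt_min (NNReal.coe_pos.2 (hf0 x)) one_pos
  have hf1 : ∀ x, f x ≤ 1 := fun x => min_le_right _ _
  have hfi : Integrable f m := by
    refine ⟨hfm.aestronglyMeasurable, lt_of_le_of_lt (lintegral_mono fun x => ?_)
      (hf0i.trans ENNReal.one_lt_top)⟩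
    rw [Real.enorm_of_nonneg (hfpos x).le]
    exact ENNReal.ofReal_le_of_le_toReal (min_le_left _ _)
  have sq_of : ∀ h : E → ℝ, Measurable h → (∀ x, 0 < h x) → (∀ x, h x ≤ f x) →
      Integrable h m ∧ MemLp h 2 m := fun h hm hp hle => by
    have hi : Integrable h m := hfi.mono' hm.aestronglyMeasurable (Eventually.of_forall fun x => by
      rw [Real.norm_eq_abs, abs_of_pos (hp x)]; exact hle x)
    refine ⟨hi, (memLp_two_iff_integrable_sq hm.aestronglyMeasurable).2 ?_⟩
    refine hi.mono' (hm.pow_const 2).aestronglyMeasurable (Eventually.of_forall fun x => ?_)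
    rw [Real.norm_eq_abs, abs_of_nonneg (sq_nonneg _)]
    nlinarith [hp x, (hle x).trans (hf1 x)]
  have hf2 := (sq_of f hfm hfpos fun _ => le_rfl).2
  set F : Lp ℝ 2 m := hf2.toLp f with hF
  have hFc : ⇑F =ᵐ[m] f := hf2.coeFn_toLp
  obtain ⟨R, hR, hbdd⟩ := ht.transient F
    ((Lp.coeFn_nonneg F).1 (hFc.mono fun x hx => by rw [hx]; exact (hfpos x).le))
    (hfi.congr hFc.symm)
  set h : E → ℝ≥0∞ := fun x => ⨆ n, ENNReal.ofReal (R n x) with hh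
  have hhm : Measurable h :=
    Measurable.iSup fun n => (Lp.stronglyMeasurable (R n)).measurable.ennreal_ofReal
  have hRh : ∀ᵐ x ∂m, ∀ n, R n x ≤ (h x).toReal := by
    filter_upwards [hbdd] with x ⟨b, hb⟩ n
    have hlt : h x ≠ ∞ := ne_of_lt (lt_of_le_of_lt
      (iSup_le fun n => ENNReal.ofReal_le_ofReal (hb ⟨n, rfl⟩)) ENNReal.ofReal_lt_top)
    rw [← ENNReal.ofReal_le_iff_le_toReal hlt]
    exact le_iSup (fun n => ENNReal.ofReal (R n x)) n
  -- The damping makes g · h ≤ f, so the energy of the potentials of g stays below ∫ f; this is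
  -- where the constant √(∫ f) comes from.
  set g : E → ℝ := fun x => f x / (1 + (h x).toReal) with hg
  have hden : ∀ x, 0 < 1 + (h x).toReal := fun x => by positivity
  have hgm : Measurable g := hfm.div (measurable_const.add hhm.ennreal_toReal)
  have hgpos : ∀ x, 0 < g x := fun x => div_pos (hfpos x) (hden x)
  have hgf : ∀ x, g x ≤ f x := fun x =>
    div_le_self (hfpos x).le (le_add_of_nonneg_right ENNReal.toReal_nonneg)
  obtain ⟨hgi, hg2⟩ := sq_of g hgm hgpos hgf
  set γ : Lp ℝ 2 m := hg2.toLp g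
  have hγc : ⇑γ =ᵐ[m] g := hg2.coeFn_toLp
  have hγ0 : 0 ≤ γ := (Lp.coeFn_nonneg γ).1 (hγc.mono fun x hx => by rw [hx]; exact (hgpos x).le)
  have hγF : γ ≤ F := (Lp.coeFn_le γ F).1 (by
    filter_upwards [hγc, hFc] with x h1 h2
    rw [h1, h2]
    exact hgf x)
  obtain ⟨R', hR', -⟩ := ht.transient γ hγ0 (hgi.congr hγc.symm)
  have hle : ∀ n, R' n ≤ R n := fun n => by
    rw [← sub_nonneg]
    refine resolvent_nonneg hS ht.markovian (α := 1 / ((n : ℝ) + 1)) (by positivity)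
      (sub_nonneg.2 hγF) ?_
    convert L.graph.sub_mem (hR n) (hR' n) using 1
    rw [Prod.mk_sub_mk, smul_sub]
    congr 1
    abel
  refine ⟨g, γ, ⟨memLp_one_iff_integrable.2 hgi, memLp_top_of_bound hgm.aestronglyMeasurable 1
    (Eventually.of_forall fun x => ?_), Eventually.of_forall hgpos⟩, hγc, √(∫ x, f x ∂m),
    Real.sqrt_nonneg _, ?_⟩
  · rw [Real.norm_eq_abs, abs_of_pos (hgpos x)]
    exact (hgf x).trans (hf1 x)
  · refine inner_le_of_resolvent_bound hS (fun n => by positivity)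
      tendsto_one_div_add_atTop_nhds_zero_nat hR' (Real.sqrt_nonneg _) fun n => ?_
    rw [Real.sq_sqrt (integral_nonneg fun x => (hfpos x).le)]
    refine (inner_L2_mono hγ0 (hle n)).trans ?_
    rw [inner_L2_eq_integral]
    refine integral_mono_ae (integrable_mul_L2 _ _) hfi ?_
    filter_upwards [hγc, hRh] with x h1 h2
    rw [h1]
    refine (mul_le_mul_of_nonneg_left (h2 n) (hgpos x).le).trans ?_
    rw [hg, div_mul_eq_mul_div, div_le_iff₀ (hden x)]
    exact mul_le_mul_of_nonneg_left (by linarith) (hfpos x).le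

end Transience

end FormDomain

/-! ### The embedding of the extended space and its injectivity -/

namespace FormDomain

section Embedding

variable {E : Type*} [MeasurableSpace E] {m : Measure E} {L S : Lp ℝ 2 m →ₗ.[ℝ] Lp ℝ 2 m}

theorem inner_abs_le (hS : IsSelfAdjoint S) (hM : IsMarkovian m S) {f : Lp ℝ 2 m} {C : ℝ}
    (hC : 0 ≤ C) (hf : ∀ v : FormDomain S, ⟪incl S v, f⟫_ℝ ≤ C * ‖v‖) (v : FormDomain S) :
    ⟪|incl S v|, f⟫_ℝ ≤ 2 * C * ‖v‖ := by
  obtain ⟨w, hw, hle⟩ := exists_abs hS hM v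
  rw [← hw]
  calc _ ≤ C * ‖w‖ := hf w
    _ ≤ C * (2 * ‖v‖) := mul_le_mul_of_nonneg_left hle hC
    _ = _ := by ring

/-- A reference function gives a bounded map of the extended space to a weighted `L¹` space. -/
theorem exists_extension (hS : IsSelfAdjoint S) (hM : IsMarkovian m S) {g : E → ℝ}
    (hg : IsWeight m g) {γ : Lp ℝ 2 m} (hγ : ⇑γ =ᵐ[m] g) {C : ℝ} (hC : 0 ≤ C)
    (hb : ∀ v : FormDomain S, ⟪incl S v, γ⟫_ℝ ≤ C * ‖v‖) :
    ∃ J : ExtendedSpace S →L[ℝ] Lp ℝ 1 (weighted m g),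
      ∀ u : FormDomain S, ⇑(J (u : ExtendedSpace S)) =ᵐ[m] ⇑(incl S u) := by
  have hi : ∀ u : FormDomain S, Integrable (incl S u) (weighted m g) := fun u => by
    rw [hg.integrable_iff]
    refine (integrable_mul_L2 γ (incl S u)).congr ?_
    filter_upwards [hγ] with x hx
    rw [hx]
  have hac := withDensity_absolutelyContinuous m fun x => ENNReal.ofReal (g x)
  let T : FormDomain S →ₗ[ℝ] Lp ℝ 1 (weighted m g) :=
    { toFun := fun u => (hi u).toL1 (incl S u)
      map_add' := fun u v => by
        rw [← Integrable.toL1_add, Integrable.toL1_eq_toL1_iff, map_add]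
        exact hac.ae_le (Lp.coeFn_add _ _)
      map_smul' := fun c u => by
        rw [RingHom.id_apply, ← Integrable.toL1_smul, Integrable.toL1_eq_toL1_iff, map_smul]
        exact hac.ae_le (Lp.coeFn_smul _ _) }
  have hT : ∀ u, ⇑(T u) =ᵐ[m] ⇑(incl S u) := fun u =>
    hg.absolutelyContinuous.ae_le (Integrable.coeFn_toL1 (hi u))
  have hnorm : ∀ u, ‖T u‖ ≤ 2 * C * ‖u‖ := fun u => by
    refine le_of_eq_of_le ?_ (inner_abs_le hS hM hC hb u)
    rw [hg.norm_eq, inner_L2_eq_integral]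
    refine integral_congr_ae ?_
    filter_upwards [hT u, hγ, Lp.coeFn_abs (incl S u)] with x h1 h2 h3
    rw [h1, h2, h3, mul_comm]
  refine ⟨T.extendOfNorm
    (UniformSpace.Completion.toComplL (𝕜 := ℝ) (E := FormDomain S)).toLinearMap, fun u => ?_⟩
  have hu : T.extendOfNorm (UniformSpace.Completion.toComplL (𝕜 := ℝ)
      (E := FormDomain S)).toLinearMap (u : ExtendedSpace S) = T u :=
    LinearMap.extendOfNorm_eq UniformSpace.Completion.denseRange_coe
      ⟨2 * C, fun x => (hnorm x).trans_eq
        (congrArg _ (UniformSpace.Completion.norm_coe x).symm)⟩ u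
  rw [hu]
  exact hT u

/-- An element of the extended space that vanishes as a function pairs to zero with the elements
of the form domain whose Laplacian is controlled by functions bounded on the form domain. -/
theorem inner_eq_zero_of_extension (hS : IsSelfAdjoint S) (hM : IsMarkovian m S) {g : E → ℝ}
    (hg : IsWeight m g) {γ : Lp ℝ 2 m} (hγ : ⇑γ =ᵐ[m] g)
    {J : ExtendedSpace S →L[ℝ] Lp ℝ 1 (weighted m g)}
    (hJ : ∀ u : FormDomain S, ⇑(J (u : ExtendedSpace S)) =ᵐ[m] ⇑(incl S u))
    {ξ : ExtendedSpace S} (hξ : J ξ = 0) {v : FormDomain S} {ψ q : Lp ℝ 2 m}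
    (hv : ∀ w : FormDomain S, ⟪w, v⟫_ℝ = ⟪incl S w, ψ⟫_ℝ) (hψ : |ψ| ≤ q) {C : ℝ} (hC : 0 ≤ C)
    (hq : ∀ w : FormDomain S, ⟪incl S w, q⟫_ℝ ≤ C * ‖w‖) :
    ⟪(v : ExtendedSpace S), ξ⟫_ℝ = 0 := by
  -- Pairing with ψ itself need not be continuous on L¹(g·m). Clipped at j g, it is, and the bound
  -- 2C on the extended space does not depend on j because |Ψ j| ≤ q.
  let Ψ : ℕ → Lp ℝ 2 m := fun j => ψ ⊓ (j : ℝ) • γ ⊔ -((j : ℝ) • γ)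
  have hγj : ∀ j : ℕ, ⇑((j : ℝ) • γ) =ᵐ[m] fun x => (j : ℝ) * g x := fun j => by
    filter_upwards [Lp.coeFn_smul (j : ℝ) γ, hγ] with x h1 h2
    rw [h1, Pi.smul_apply, h2, smul_eq_mul]
  have hΨ : ∀ j, ⇑(Ψ j) =ᵐ[m] fun x => clip (j * g x) (ψ x) := fun j => by
    filter_upwards [coeFn_clip_L2 ((j : ℝ) • γ) ψ, hγj j] with x h1 h2
    rw [h1, h2]
  have hΨψ : ∀ j, ∀ᵐ x ∂m, |Ψ j x| ≤ |ψ x| := fun j => by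
    filter_upwards [hΨ j, hg.pos] with x h1 h2
    rw [h1]
    exact abs_clip_le_abs (by positivity) _
  have hΨg : ∀ j : ℕ, ∀ᵐ x ∂m, |Ψ j x| ≤ j * g x := fun j => by
    filter_upwards [hΨ j, hg.pos] with x h1 h2
    rw [h1]
    exact abs_clip_le (by positivity) _
  have hΨlim : ∀ᵐ x ∂m, Tendsto (fun j => Ψ j x) atTop (𝓝 (ψ x)) := by
    filter_upwards [ae_all_iff.2 hΨ, hg.pos] with x h1 h2
    simp only [h1]
    refine tendsto_const_nhds.congr' ?_
    filter_upwards [tendsto_natCast_atTop_atTop.eventually_ge_atTop (|ψ x| / g x)] with j hj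
    exact (clip_eq_self ((div_le_iff₀ h2).1 hj)).symm
  have hbound : ∀ j (w : FormDomain S), |⟪incl S w, Ψ j⟫_ℝ| ≤ 2 * C * ‖w - ξ‖ := by
    intro j w
    obtain ⟨ℓ, hℓ⟩ := hg.exists_functional (Lp.aestronglyMeasurable (Ψ j)) (hΨg j)
    have hℓw : ∀ w : FormDomain S, ℓ (J w) = ⟪incl S w, Ψ j⟫_ℝ := fun w => by
      rw [hℓ, inner_L2_eq_integral]
      refine integral_congr_ae ?_
      filter_upwards [hJ w] with x hx
      rw [hx, mul_comm]
    have hΨq : |Ψ j| ≤ q := by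
      refine le_trans ?_ hψ
      rw [← Lp.coeFn_le]
      filter_upwards [hΨψ j, Lp.coeFn_abs (Ψ j), Lp.coeFn_abs ψ] with x h1 h2 h3
      rwa [h2, h3]
    have hall : ∀ η : ExtendedSpace S, |ℓ (J η)| ≤ 2 * C * ‖η‖ := fun η => by
      induction η using UniformSpace.Completion.induction_on with
      | hp => exact isClosed_le (ℓ.continuous.comp J.continuous).abs (continuous_norm.const_mul _)
      | ih w =>
        rw [hℓw, UniformSpace.Completion.norm_coe]
        exact (abs_inner_L2_le hΨq).trans (inner_abs_le hS hM hC hq w)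
    -- Since Jξ = 0, subtracting ξ does not change the functional. The resulting bound survives j →
    -- ∞ and then w → ξ, where its right side is zero.
    have := hall (w - ξ)
    rwa [map_sub, map_sub, hξ, map_zero, sub_zero, hℓw] at this
  have hlim : ∀ w : FormDomain S, |⟪(w : ExtendedSpace S), v⟫_ℝ| ≤ 2 * C * ‖w - ξ‖ := fun w => by
    rw [UniformSpace.Completion.inner_coe, hv]
    have h := (tendsto_inner_L2_of_ae hΨψ hΨlim (incl S w)).abs
    simp only [real_inner_comm (incl S w)] at h
    exact le_of_tendsto' h fun j => hbound j w
  have hext : ∀ η : ExtendedSpace S, |⟪η, (v : ExtendedSpace S)⟫_ℝ| ≤ 2 * C * ‖η - ξ‖ := fun η => by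
    induction η using UniformSpace.Completion.induction_on with
    | hp =>
      exact isClosed_le (continuous_id.inner continuous_const).abs
        ((continuous_id.sub continuous_const).norm.const_mul _)
    | ih w => exact hlim w
  have := hext ξ
  rw [sub_self, norm_zero, mul_zero, abs_nonpos_iff] at this
  rw [real_inner_comm]
  exact this

/-- For |f| ≤ k γ, positivity gives |G_1 f| ≤ k q with q = G_1 γ. Thus ψ = f - G_1 f is dominated by
k (γ + q), and pairing with q is form-bounded because (w, q) = (w, γ) - ℰ(w, q). -/
theorem injective_extension (hL : IsSelfAdjoint L) (hS : IsSqrtNeg L S)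
    (hker : ∀ u : L.domain, L u = 0 → u = 0) (ht : IsTransientDirichletSpace m L S) {g : E → ℝ}
    (hg : IsWeight m g) {γ : Lp ℝ 2 m} (hγ : ⇑γ =ᵐ[m] g) {C : ℝ} (hC : 0 ≤ C)
    (hb : ∀ v : FormDomain S, ⟪incl S v, γ⟫_ℝ ≤ C * ‖v‖)
    {J : ExtendedSpace S →L[ℝ] Lp ℝ 1 (weighted m g)}
    (hJ : ∀ u : FormDomain S, ⇑(J (u : ExtendedSpace S)) =ᵐ[m] ⇑(incl S u)) :
    Function.Injective J := by
  rw [injective_iff_map_eq_zero]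
  intro ξ hξ
  have hpos : ∀ᵐ x ∂m, 0 < γ x := by
    filter_upwards [hγ, hg.pos] with x h1 h2
    rwa [h1]
  have hγ0 : 0 ≤ γ := (Lp.coeFn_nonneg γ).1 (hpos.mono fun x hx => hx.le)
  have hγi : Integrable γ m := (memLp_one_iff_integrable.1 hg.memL1).congr hγ.symm
  have hdom : ∀ f ∈ dominatedBy γ, Integrable f m := by
    rintro f ⟨k, hk, hf⟩
    refine (hγi.const_mul k).mono' (Lp.aestronglyMeasurable f) ?_
    filter_upwards [(Lp.coeFn_le _ _).2 hf, Lp.coeFn_abs f, Lp.coeFn_smul k γ] with x h1 h2 h3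
    rwa [h2, h3] at h1
  obtain ⟨q, hq⟩ := exists_resolvent_of_integrable ht.transient hγi
  obtain ⟨vq, hvq, hqw⟩ := exists_of_resolvent hS (α := 1) (f := γ) (x := q) (by rwa [one_smul])
  refine extended_eq_zero_of_inner_resolvent hL hS hker (dominatedBy_orthogonal hγ0 hpos)
    (fun f hf => exists_resolvent_of_integrable ht.transient (hdom f hf)) ?_
  rintro f ⟨k, hk, hf⟩ v hv hw
  obtain ⟨hf2, hf1⟩ := abs_le'.1 hf
  have hmem : ∀ {x y f g : Lp ℝ 2 m}, (x, x - f) ∈ L.graph → (y, y - g) ∈ L.graph →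
      (x - y, (1 : ℝ) • (x - y) - (f - g)) ∈ L.graph := fun h1 h2 => by
    convert L.graph.sub_mem h1 h2 using 1
    rw [Prod.mk_sub_mk, one_smul]
    congr 1
    abel
  have hkq : (k • q, k • q - k • γ) ∈ L.graph := by
    rw [← smul_sub]
    exact L.graph.smul_mem k hq
  have hmv : (-incl S v, -incl S v - -f) ∈ L.graph := by
    convert L.graph.neg_mem hv using 1
    rw [Prod.neg_mk]
    congr 1
    abel
  have h1 : incl S v ≤ k • q := sub_nonneg.1
    (resolvent_nonneg hS ht.markovian one_pos (sub_nonneg.2 hf2) (hmem hkq hv))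
  have h2 : -incl S v ≤ k • q := sub_nonneg.1
    (resolvent_nonneg hS ht.markovian one_pos (sub_nonneg.2 hf1) (hmem hkq hmv))
  refine inner_eq_zero_of_extension hS.selfAdjoint ht.markovian hg hγ hJ hξ hw
    (q := k • γ + k • q) (C := k * (C + (C + ‖vq‖))) ?_ (by positivity) fun w => ?_
  · refine abs_le'.2 ⟨?_, ?_⟩
    · rw [sub_eq_add_neg]
      exact add_le_add hf2 h2
    · rw [neg_sub, sub_eq_neg_add]
      exact add_le_add hf1 h1
  · have e1 := hqw w
    have e2 := hb w
    have e3 := abs_le.1 (abs_real_inner_le_norm w vq)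
    rw [← smul_add, inner_smul_right, inner_add_right, mul_assoc]
    refine mul_le_mul_of_nonneg_left ?_ hk
    linarith [e3.1]

end Embedding

end FormDomain

theorem conditionL1_of_transient {E : Type*} [MeasurableSpace E] {m : Measure E} [SigmaFinite m]
    {L S : Lp ℝ 2 m →ₗ.[ℝ] Lp ℝ 2 m} (hL : IsSelfAdjoint L) (hS : IsSqrtNeg L S)
    (hker : ∀ u : L.domain, L u = 0 → u = 0) (ht : IsTransientDirichletSpace m L S) :
    ConditionL1 m S := by
  obtain ⟨g, γ, hg, hγ, C, hC, hb⟩ := FormDomain.exists_reference hS ht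
  obtain ⟨J, hJ⟩ := FormDomain.exists_extension hS.selfAdjoint ht.markovian hg hγ hC hb
  exact ⟨g, J, hg, FormDomain.injective_extension hL hS hker ht hg hγ hC hb hJ, hJ⟩

/-! ### Orlicz spaces -/

/-- The properties shared by Young functions and their duals that are needed below. -/
structure IsOrliczFunction (M : ℝ → ℝ) : Prop where
  nonneg : ∀ s, 0 ≤ M s
  convex : ConvexOn ℝ Set.univ M
  even : ∀ s, M (-s) = M s
  zero : M 0 = 0

theorem IsYoungFunction.isOrliczFunction {N : ℝ → ℝ} (h : IsYoungFunction N) :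
    IsOrliczFunction N :=
  ⟨h.nonneg, h.convex, h.even, (h.eq_zero_iff 0).2 rfl⟩

/-- Superlinear growth makes r |s| - N(r) nonpositive for large r. Without boundedness the real
supremum in `youngDual` would take its default value. -/
theorem IsYoungFunction.bddAbove_dual {N : ℝ → ℝ} (h : IsYoungFunction N) (s : ℝ) :
    BddAbove ((fun r : ℝ => r * |s| - N r) '' Set.Ici 0) := by
  obtain ⟨R, hR⟩ := eventually_atTop.1 (h.tendsto_atTop.eventually_ge_atTop |s|)
  refine ⟨max R 0 * |s|, ?_⟩
  rintro _ ⟨r, hr, rfl⟩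
  rw [Set.mem_Ici] at hr
  have hN := h.nonneg r
  change r * |s| - N r ≤ _
  rcases le_or_gt r (max R 0) with h1 | h1
  · linarith [mul_le_mul_of_nonneg_right h1 (abs_nonneg s)]
  · obtain ⟨h2, h3⟩ := max_lt_iff.1 h1
    have h4 := hR r h2.le
    rw [le_div_iff₀ h3] at h4
    have : 0 ≤ max R 0 * |s| := by positivity
    linarith

theorem IsYoungFunction.le_dual {N : ℝ → ℝ} (h : IsYoungFunction N) {r : ℝ} (hr : 0 ≤ r) (s : ℝ) :
    r * |s| - N r ≤ youngDual N s :=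
  le_csSup (h.bddAbove_dual s) ⟨r, hr, rfl⟩

theorem youngDual_le {N : ℝ → ℝ} {s b : ℝ} (h : ∀ r : ℝ, 0 ≤ r → r * |s| - N r ≤ b) :
    youngDual N s ≤ b := by
  refine csSup_le (Set.Nonempty.image _ ⟨0, Set.mem_Ici.2 le_rfl⟩) ?_
  rintro _ ⟨r, hr, rfl⟩
  exact h r hr

theorem IsYoungFunction.isOrliczFunction_dual {N : ℝ → ℝ} (h : IsYoungFunction N) :
    IsOrliczFunction (youngDual N) where
  nonneg s := by
    have := h.le_dual le_rfl s
    rwa [zero_mul, h.isOrliczFunction.zero, sub_zero] at this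
  convex := by
    refine ⟨convex_univ, fun s _ t _ a b ha hb hab => youngDual_le fun r hr => ?_⟩
    have h1 := mul_le_mul_of_nonneg_left (h.le_dual hr s) ha
    have h2 := mul_le_mul_of_nonneg_left (h.le_dual hr t) hb
    have h3 : |a • s + b • t| ≤ a * |s| + b * |t| := by
      refine (abs_add_le _ _).trans_eq ?_
      rw [smul_eq_mul, smul_eq_mul, abs_mul, abs_mul, abs_of_nonneg ha, abs_of_nonneg hb]
    have h4 := mul_le_mul_of_nonneg_left h3 hr
    have h5 : N r = a * N r + b * N r := by rw [← add_mul, hab, one_mul]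
    simp only [smul_eq_mul] at h4 ⊢
    linarith
  even s := by rw [youngDual, youngDual, abs_neg]
  zero := by
    refine le_antisymm (youngDual_le fun r _ => ?_) ?_
    · rw [abs_zero, mul_zero, zero_sub, neg_nonpos]
      exact h.nonneg r
    · have := h.le_dual le_rfl 0
      rwa [zero_mul, h.isOrliczFunction.zero, sub_zero] at this

namespace IsOrliczFunction

variable {M : ℝ → ℝ}

theorem continuous (hM : IsOrliczFunction M) : Continuous M :=
  continuousOn_univ.1 (hM.convex.continuousOn isOpen_univ)

theorem apply_abs (hM : IsOrliczFunction M) (s : ℝ) : M |s| = M s := by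
  rcases abs_choice s with h | h <;> rw [h]
  exact hM.even s

/-- On [0, K] a convex function lies below its chord, which starts at M 0 = 0. The linear bound
gives monotonicity and finite modulars of bounded integrable functions. -/
theorem le_mul (hM : IsOrliczFunction M) {s K : ℝ} (hK : 0 < K) (hs : |s| ≤ K) :
    M s ≤ |s| * (M K / K) := by
  have h0 : 0 ≤ |s| / K := by positivity
  have h := hM.convex.2 (Set.mem_univ K) (Set.mem_univ 0) h0
    (sub_nonneg.2 ((div_le_one hK).2 hs)) (add_sub_cancel _ _)
  rw [smul_zero, add_zero, hM.zero, smul_zero, add_zero, smul_eq_mul, smul_eq_mul,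
    div_mul_cancel₀ _ hK.ne', hM.apply_abs] at h
  exact h.trans_eq (by ring)

theorem mono (hM : IsOrliczFunction M) {a b : ℝ} (h : |a| ≤ |b|) : M a ≤ M b := by
  rcases (abs_nonneg b).eq_or_lt with hb | hb
  · rw [← hb] at h
    rw [abs_nonpos_iff.1 h, hM.zero]
    exact hM.nonneg b
  · refine (hM.le_mul hb h).trans ?_
    rw [hM.apply_abs, mul_div_assoc', div_le_iff₀ hb, mul_comm]
    exact mul_le_mul_of_nonneg_left h (hM.nonneg b)

theorem add_le (hM : IsOrliczFunction M) (a b : ℝ) : M (a + b) ≤ M (2 * a) + M (2 * b) := by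
  have h0 : (0 : ℝ) ≤ 1 / 2 := by norm_num
  have h := hM.convex.2 (Set.mem_univ (2 * a)) (Set.mem_univ (2 * b)) h0 h0 (by norm_num)
  simp only [smul_eq_mul] at h
  rw [show 1 / 2 * (2 * a) + 1 / 2 * (2 * b) = a + b by ring] at h
  linarith [hM.nonneg (2 * a), hM.nonneg (2 * b)]

end IsOrliczFunction

/-! ### Modulars and Δ₂-regularity -/

section Modular

variable {E : Type*} [MeasurableSpace E] {m : Measure E} {M : ℝ → ℝ}

theorem modular_congr {f h : E → ℝ} (hfh : f =ᵐ[m] h) : modular m M f = modular m M h :=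
  lintegral_congr_ae (hfh.mono fun x hx => by simp only [hx])

theorem MemOrlicz.congr {f h : E → ℝ} (hf : MemOrlicz m M f) (hfh : f =ᵐ[m] h) :
    MemOrlicz m M h := by
  obtain ⟨h1, α, hα, h2⟩ := hf
  have h3 : (fun x => α * f x) =ᵐ[m] fun x => α * h x := hfh.mono fun x hx => by simp only [hx]
  exact ⟨h1.congr hfh, α, hα, modular_congr (M := M) h3 ▸ h2⟩

namespace IsOrliczFunction

theorem modular_mono (hM : IsOrliczFunction M) {f h : E → ℝ} (hfh : ∀ᵐ x ∂m, |f x| ≤ |h x|) :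
    modular m M f ≤ modular m M h :=
  lintegral_mono_ae (hfh.mono fun _ hx => ENNReal.ofReal_le_ofReal (hM.mono hx))

theorem aemeasurable (hM : IsOrliczFunction M) {f : E → ℝ} (hf : AEStronglyMeasurable f m) :
    AEMeasurable (fun x => ENNReal.ofReal (M (f x))) m :=
  (hM.continuous.comp_aestronglyMeasurable hf).aemeasurable.ennreal_ofReal

theorem modular_add_le (hM : IsOrliczFunction M) {f h : E → ℝ} (hf : AEStronglyMeasurable f m) :
    modular m M (fun x => f x + h x) ≤
      modular m M (fun x => 2 * f x) + modular m M (fun x => 2 * h x) := by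
  rw [modular, modular, modular, ← lintegral_add_left' (hM.aemeasurable (hf.const_mul 2))]
  refine lintegral_mono fun x => ?_
  rw [← ENNReal.ofReal_add (hM.nonneg _) (hM.nonneg _)]
  exact ENNReal.ofReal_le_ofReal (hM.add_le _ _)

/-- Dominated convergence for modulars. -/
theorem tendsto_modular (hM : IsOrliczFunction M) {F : ℕ → E → ℝ} {H : E → ℝ}
    (hF : ∀ n, AEStronglyMeasurable (F n) m) (hb : ∀ n, ∀ᵐ x ∂m, |F n x| ≤ |H x|)
    (hH : modular m M H < ∞) (hlim : ∀ᵐ x ∂m, Tendsto (fun n => F n x) atTop (𝓝 0)) :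
    Tendsto (fun n => modular m M (F n)) atTop (𝓝 0) := by
  have h := tendsto_lintegral_of_dominated_convergence' (f := fun _ => 0) _
    (fun n => hM.aemeasurable (hF n))
    (fun n => (hb n).mono fun x hx => ENNReal.ofReal_le_ofReal (hM.mono hx)) hH.ne ?_
  · rw [lintegral_zero] at h
    exact h
  · filter_upwards [hlim] with x hx
    have := ENNReal.tendsto_ofReal ((hM.continuous.tendsto 0).comp hx)
    rwa [hM.zero, ENNReal.ofReal_zero] at this

/-- Multiples of bounded integrable functions have finite modular. -/
theorem modular_lt_top (hM : IsOrliczFunction M) {f : E → ℝ} (h1 : MemLp f 1 m)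
    (h2 : MemLp f ∞ m) (c : ℝ) : modular m M (fun x => c * f x) < ∞ := by
  have h3 : ∀ᵐ x ∂m, |c * f x| ≤ |c| * (eLpNormEssSup f m).toReal + 1 := by
    have h4 : eLpNormEssSup f m ≠ ∞ := by
      rw [← eLpNorm_exponent_top]
      exact h2.2.ne
    filter_upwards [ae_le_eLpNormEssSup (f := f) (μ := m)] with x hx
    have h5 : |f x| ≤ (eLpNormEssSup f m).toReal := by
      rw [← ENNReal.ofReal_le_iff_le_toReal h4]
      rwa [← Real.norm_eq_abs, ofReal_norm]
    rw [abs_mul]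
    linarith [mul_le_mul_of_nonneg_left h5 (abs_nonneg c)]
  set K := |c| * (eLpNormEssSup f m).toReal + 1
  have hK : 0 < K := by positivity
  have h6 : Integrable (fun x => |c * f x| * (M K / K)) m :=
    (((memLp_one_iff_integrable.1 h1).const_mul c).abs).mul_const _
  refine lt_of_le_of_lt (lintegral_mono_ae (h3.mono fun x hx =>
    ENNReal.ofReal_le_ofReal (hM.le_mul hK hx))) ?_
  exact h6.lintegral_lt_top

theorem memOrlicz (hM : IsOrliczFunction M) {f : E → ℝ} (h1 : MemLp f 1 m) (h2 : MemLp f ∞ m) :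
    MemOrlicz m M f :=
  ⟨h1.1, 1, one_pos, hM.modular_lt_top h1 h2 1⟩

theorem modular_two_mul_lt_top (hΔ : IsDelta2Regular m M) {f : E → ℝ}
    (hf : modular m M f < ∞) : modular m M (fun x => 2 * f x) < ∞ := by
  obtain ⟨c, hc, h⟩ := hΔ
  set e : ℝ := if m Set.univ < ∞ then 1 else 0 with he
  have he0 : 0 ≤ e := by rw [he]; split_ifs <;> norm_num
  have h1 : modular m M (fun x => 2 * f x) ≤
      ∫⁻ x, ENNReal.ofReal c * (ENNReal.ofReal (M (f x)) + ENNReal.ofReal e) ∂m := by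
    refine lintegral_mono fun x => (ENNReal.ofReal_le_ofReal (h (f x))).trans ?_
    rw [ENNReal.ofReal_mul hc.le]
    gcongr
    exact ENNReal.ofReal_add_le
  refine h1.trans_lt ?_
  rw [lintegral_const_mul' _ _ ENNReal.ofReal_ne_top, lintegral_add_right _ measurable_const,
    lintegral_const]
  refine ENNReal.mul_lt_top ENNReal.ofReal_lt_top (ENNReal.add_lt_top.2 ⟨hf, ?_⟩)
  rw [he]
  split_ifs with h2
  · exact ENNReal.mul_lt_top ENNReal.ofReal_lt_top h2
  -- For m(E) = ∞ the additive constant is 0, and 0 · ∞ = 0.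
  · simp

/-- Under `Δ₂`-regularity all multiples of elements of the Orlicz space have finite modular. -/
theorem modular_const_mul_lt_top (hM : IsOrliczFunction M) (hΔ : IsDelta2Regular m M) {f : E → ℝ}
    (hf : MemOrlicz m M f) (c : ℝ) : modular m M (fun x => c * f x) < ∞ := by
  obtain ⟨-, α, hα, h⟩ := hf
  have hpow : ∀ n : ℕ, modular m M (fun x => 2 ^ n * (α * f x)) < ∞ := fun n => by
    induction n with
    | zero => simpa using h
    | succ n ih =>
      have := modular_two_mul_lt_top hΔ ih
      simpa only [pow_succ', mul_assoc] using this
  obtain ⟨n, hn⟩ := pow_unbounded_of_one_lt (|c| / α) one_lt_two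
  rw [div_lt_iff₀ hα] at hn
  refine lt_of_le_of_lt (hM.modular_mono (Eventually.of_forall fun x => ?_)) (hpow n)
  rw [← mul_assoc, abs_mul, abs_mul (2 ^ n * α), abs_of_pos (a := 2 ^ n * α) (by positivity)]
  exact mul_le_mul_of_nonneg_right hn.le (abs_nonneg _)

end IsOrliczFunction

/-- The admissible value l = ε/2 leaves room for the strict inequality. -/
theorem orliczNorm_lt {f : E → ℝ} {ε : ℝ} (hε : 0 < ε)
    (h : modular m M (fun x => 2 / ε * f x) ≤ 1) : orliczNorm m M f < ε := by
  refine lt_of_le_of_lt (csInf_le ⟨0, fun l hl => hl.1.le⟩ ⟨half_pos hε, ?_⟩) (half_lt_self hε)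
  refine le_of_eq_of_le (congrArg _ ?_) h
  funext x
  field_simp

theorem aestronglyMeasurable_clip {c f : E → ℝ} (hc : AEStronglyMeasurable c m)
    (hf : AEStronglyMeasurable f m) : AEStronglyMeasurable (fun x => clip (c x) (f x)) m :=
  (hf.inf hc).sup hc.neg

/-- Clipping at levels tending to infinity approximates elements of a `Δ₂`-regular Orlicz space in
modular. -/
theorem IsOrliczFunction.exists_modular_sub_clip_lt (hM : IsOrliczFunction M)
    (hΔ : IsDelta2Regular m M) {f : E → ℝ} (hf : MemOrlicz m M f) {φ : ℕ → E → ℝ}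
    (hφ : ∀ n, AEStronglyMeasurable (φ n) m) (hφ0 : ∀ n, ∀ᵐ x ∂m, 0 ≤ φ n x)
    (hlim : ∀ᵐ x ∂m, Tendsto (fun n => φ n x) atTop atTop) (c : ℝ) {δ : ℝ≥0∞} (hδ : 0 < δ) :
    ∃ n, modular m M (fun x => c * (f x - clip (φ n x) (f x))) < δ := by
  have h := hM.tendsto_modular (F := fun n x => c * (f x - clip (φ n x) (f x)))
    (H := fun x => c * f x)
    (fun n => (hf.1.sub (aestronglyMeasurable_clip (hφ n) hf.1)).const_mul c) (fun n => ?_)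
    (hM.modular_const_mul_lt_top hΔ hf c) ?_
  · exact (h.eventually_lt_const hδ).exists
  · filter_upwards [hφ0 n] with x hx
    rw [abs_mul, abs_mul]
    exact mul_le_mul_of_nonneg_left (abs_sub_clip_le hx _) (abs_nonneg _)
  · filter_upwards [hlim] with x hx
    refine tendsto_const_nhds.congr' ?_
    filter_upwards [hx.eventually_ge_atTop |f x|] with n hn
    rw [clip_eq_self hn, sub_self, mul_zero]

end Modular

/-! ### Density in the extended space, its dual and the Orlicz spaces -/

section Density

open FormDomain

variable {E : Type*} [MeasurableSpace E] {m : Measure E} {S : Lp ℝ 2 m →ₗ.[ℝ] Lp ℝ 2 m}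
  {g : E → ℝ} {J : ExtendedSpace S →L[ℝ] Lp ℝ 1 (weighted m g)}

theorem mem_interOrlicz_of_boundedIntegrable (hJ : IsL1Embedding m S g J) {M : ℝ → ℝ}
    (hM : IsOrliczFunction M) {u : FormDomain S} (hu : u ∈ boundedIntegrable S) :
    (u : ExtendedSpace S) ∈ interOrlicz J M :=
  (hM.memOrlicz hu.1 hu.2).congr (hJ.extends_incl u).symm

theorem mem_spaceV_of_le (hJ : IsL1Embedding m S g J) {N : ℝ → ℝ} (hN : IsOrliczFunction N)
    {u : E → ℝ} (hu : AEStronglyMeasurable u m) {c : ℝ} (hc : ∀ᵐ x ∂m, |u x| ≤ c * g x) :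
    u ∈ spaceV J N := by
  have hle : ∀ᵐ x ∂m, ‖u x‖ ≤ ‖c * g x‖ := hc.mono fun x hx => hx.trans (le_abs_self _)
  refine ⟨hN.memOrlicz ((hJ.weight.memL1.const_mul c).of_le hu hle)
    ((hJ.weight.memLinfty.const_mul c).of_le hu hle), ?_⟩
  obtain ⟨ℓ, hℓ⟩ := hJ.weight.exists_functional hu hc
  refine ⟨‖ℓ.comp J‖ + 1, by positivity, fun v _ => ?_⟩
  rw [← hℓ]
  calc ℓ (J v) ≤ ‖ℓ.comp J v‖ := le_abs_self _
    _ ≤ ‖ℓ.comp J‖ * ‖v‖ := (ℓ.comp J).le_opNorm v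
    _ ≤ (‖ℓ.comp J‖ + 1) * ‖v‖ := by linarith [norm_nonneg v]

theorem IsWeight.memL2 (hg : IsWeight m g) : MemLp g 2 m := by
  rw [memLp_two_iff_integrable_sq hg.memL1.1]
  simp only [pow_two]
  exact hg.memL1.integrable_mul hg.memLinfty

/-- The form domain contains bounded integrable functions tending to infinity. -/
theorem exists_boundedIntegrable_tendsto_atTop (hS : IsSelfAdjoint S) (hM : IsMarkovian m S)
    (hg : IsWeight m g) :
    ∃ φ : ℕ → FormDomain S, (∀ n, φ n ∈ boundedIntegrable S) ∧
      (∀ n, ∀ᵐ x ∂m, 0 ≤ incl S (φ n) x) ∧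
      ∀ᵐ x ∂m, Tendsto (fun n => incl S (φ n) x) atTop atTop := by
  obtain ⟨u, hu, hlim⟩ := exists_seq_ae_tendsto_of_dense (dense_range_incl hS)
    (hg.memL2.toLp g)
  choose v hv using hu
  choose w hw hw' _ using fun n => exists_slab hM n (v n)
  have hφ : ∀ n : ℕ, ⇑(incl S ((n : ℝ) • w n)) =ᵐ[m] fun x => n * slab n (u n x) := fun n => by
    rw [map_smul]
    filter_upwards [Lp.coeFn_smul (n : ℝ) (incl S (w n)), hw' n] with x h1 h2
    rw [h1, Pi.smul_apply, h2, smul_eq_mul, hv]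
  refine ⟨fun n => (n : ℝ) • w n, fun n => (boundedIntegrable S).smul_mem _ (hw n),
    fun n => ?_, ?_⟩
  · filter_upwards [hφ n] with x hx
    rw [hx]
    exact mul_nonneg n.cast_nonneg (slab_nonneg _ _)
  · filter_upwards [ae_all_iff.2 hφ, hlim, hg.memL2.coeFn_toLp, hg.pos] with x h1 h2 h3 h4
    simp only [h1]
    rw [h3] at h2
    -- The slabs of approximants of g tend a.e. to g > 0, so multiplying them by n drives them to
    -- infinity.
    refine tendsto_natCast_atTop_atTop.atTop_mul_pos ?_ (tendsto_slab h2)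
    rwa [max_eq_left h4.le]

/-- Clipping an element of the form domain at the level of a nonnegative bounded integrable one. -/
theorem exists_clip (hS : IsSelfAdjoint S) (hM : IsMarkovian m S) {φ : FormDomain S}
    (hφ : φ ∈ boundedIntegrable S) (hφ0 : ∀ᵐ x ∂m, 0 ≤ incl S φ x) (u : FormDomain S) :
    ∃ v ∈ boundedIntegrable S, ⇑(incl S v) =ᵐ[m] fun x => clip (incl S φ x) (incl S u x) := by
  obtain ⟨a, ha⟩ := exists_inf hS hM u φ
  obtain ⟨b, hb⟩ := exists_sup hS hM a (-φ)
  rw [ha, map_neg] at hb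
  have hclip := coeFn_clip_L2 (incl S φ) (incl S u)
  rw [← hb] at hclip
  have hle : ∀ᵐ x ∂m, ‖incl S b x‖ ≤ ‖incl S φ x‖ := by
    filter_upwards [hclip, hφ0] with x h1 h2
    rw [h1]
    exact (abs_clip_le h2 _).trans (le_abs_self _)
  exact ⟨b, ⟨hφ.1.of_le (Lp.aestronglyMeasurable _) hle,
    hφ.2.of_le (Lp.aestronglyMeasurable _) hle⟩, hclip⟩

/-- First f is clipped at a large φ_n ∈ D(ℰ). The result p lies in L², hence is an a.e. limit of
elements of D(ℰ); clipping these at the same φ_n keeps the error below 2 φ_n, whose multiples have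
finite modular. -/
theorem exists_boundedIntegrable_orliczNorm_lt (hS : IsSelfAdjoint S) (hMk : IsMarkovian m S)
    (hg : IsWeight m g) {M : ℝ → ℝ} (hM : IsOrliczFunction M) (hΔ : IsDelta2Regular m M)
    {f : E → ℝ} (hf : MemOrlicz m M f) {ε : ℝ} (hε : 0 < ε) :
    ∃ v ∈ boundedIntegrable S, orliczNorm m M (f - incl S v) < ε := by
  obtain ⟨φ, hφ, hφ0, hφlim⟩ := exists_boundedIntegrable_tendsto_atTop hS hMk hg
  have hhalf : (0 : ℝ≥0∞) < 1 / 2 := by simp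
  -- The factor 2/ε is the one in `orliczNorm_lt`, the extra 2 comes from `modular_add_le`, and each
  -- of the two errors may use up modular 1/2.
  obtain ⟨n, hn⟩ := hM.exists_modular_sub_clip_lt hΔ hf
    (fun n => Lp.aestronglyMeasurable (incl S (φ n))) hφ0 hφlim (2 * (2 / ε)) hhalf
  set p : E → ℝ := fun x => clip (incl S (φ n) x) (f x) with hp
  have hpm : AEStronglyMeasurable p m :=
    aestronglyMeasurable_clip (Lp.aestronglyMeasurable _) hf.1
  have hpφ : ∀ᵐ x ∂m, |p x| ≤ incl S (φ n) x := (hφ0 n).mono fun x hx => abs_clip_le hx _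
  have hp2 : MemLp p 2 m := (Lp.memLp (incl S (φ n))).of_le hpm
    (hpφ.mono fun x hx => hx.trans (le_abs_self _))
  obtain ⟨u, hu, hulim⟩ := exists_seq_ae_tendsto_of_dense (dense_range_incl hS) (hp2.toLp p)
  choose w hw using hu
  choose v hv hvc using fun j => exists_clip hS hMk (hφ n) (hφ0 n) (w j)
  have hlim : Tendsto (fun j => modular m M (fun x => 2 * (2 / ε) * (p x - incl S (v j) x))) atTop
      (𝓝 0) := by
    refine hM.tendsto_modular (H := fun x => 2 * (2 / ε) * 2 * incl S (φ n) x)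
      (fun j => (hpm.sub (Lp.aestronglyMeasurable _)).const_mul _) (fun j => ?_)
      (hM.modular_lt_top (hφ n).1 (hφ n).2 _) ?_
    · filter_upwards [hpφ, hvc j, hφ0 n] with x h1 h2 h3
      have h4 : |incl S (v j) x| ≤ incl S (φ n) x := by
        rw [h2]
        exact abs_clip_le h3 _
      rw [mul_assoc (2 * (2 / ε)) 2, abs_mul (2 * (2 / ε)), abs_mul (2 * (2 / ε)),
        abs_mul 2 (incl S (φ n) x), abs_two, abs_of_nonneg h3]
      refine mul_le_mul_of_nonneg_left ?_ (abs_nonneg _)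
      linarith [abs_sub (p x) (incl S (v j) x)]
    · filter_upwards [hulim, hp2.coeFn_toLp, ae_all_iff.2 hvc, hpφ] with x h1 h2 h3 h4
      rw [h2] at h1
      have h5 := ((continuous_clip (incl S (φ n) x)).tendsto _).comp h1
      rw [clip_eq_self h4] at h5
      have h6 := (h5.const_sub (p x)).const_mul (2 * (2 / ε))
      rw [sub_self, mul_zero] at h6
      refine h6.congr fun j => ?_
      rw [h3, Function.comp_apply, hw]
  obtain ⟨j, hj⟩ := (hlim.eventually_lt_const hhalf).exists
  refine ⟨v j, hv j, orliczNorm_lt hε ?_⟩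
  have e : (fun x => 2 / ε * (f - ⇑(incl S (v j))) x) =
      fun x => 2 / ε * (f x - p x) + 2 / ε * (p x - incl S (v j) x) := by
    funext x
    rw [Pi.sub_apply]
    ring
  rw [e]
  refine (hM.modular_add_le ((hf.1.sub hpm).const_mul _)).trans ?_
  simp only [← mul_assoc]
  refine (add_le_add hn.le hj.le).trans ?_
  rw [ENNReal.add_halves]

theorem conditionN1_of_embedding (hS : IsSelfAdjoint S) (hMk : IsMarkovian m S)
    (hJ : IsL1Embedding m S g J) {N : ℝ → ℝ} (hN : IsOrliczFunction (youngDual N))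
    (hΔ : IsDelta2Regular m (youngDual N)) : ConditionN1 J N := by
  refine ⟨(dense_coe_boundedIntegrable hS hMk).mono ?_, ?_, fun f hf ε hε => ?_⟩
  · rintro _ ⟨u, hu, rfl⟩
    exact mem_interOrlicz_of_boundedIntegrable hJ hN hu
  · rintro _ ⟨v, hv, rfl⟩
    exact hv
  · obtain ⟨v, hv, hlt⟩ := exists_boundedIntegrable_orliczNorm_lt hS hMk hJ.weight hN hΔ hf hε
    refine ⟨_, ⟨v, mem_interOrlicz_of_boundedIntegrable hJ hN hv, rfl⟩, lt_of_eq_of_lt ?_ hlt⟩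
    have h := hJ.extends_incl v
    simp only [orliczNorm]
    congr 1
    ext l
    simp only [Set.mem_ofPred_eq]
    rw [modular_congr]
    filter_upwards [h] with x hx
    rw [Pi.sub_apply, Pi.sub_apply, hx]

/-- `K` consists of the Riesz representatives of the functions dominated by a multiple of g. Since
these separate points of L¹(g·m), injectivity of J makes the orthogonal complement of `K` trivial.
-/
theorem dense_spaceVInDual (hJ : IsL1Embedding m S g J) {N : ℝ → ℝ} (hN : IsOrliczFunction N) :
    Dense (spaceVInDual J N) := by
  let K : Submodule ℝ (ExtendedSpace S) :=
    { carrier := {ζ | ∃ (u : E → ℝ) (c : ℝ), AEStronglyMeasurable u m ∧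
        (∀ᵐ x ∂m, |u x| ≤ c * g x) ∧ ∀ v, ⟪ζ, v⟫_ℝ = ∫ x, u x * J v x ∂m}
      zero_mem' := ⟨0, 0, aestronglyMeasurable_zero, by simp, by simp⟩
      add_mem' := by
        rintro a b ⟨u, c, hu, hc, ha⟩ ⟨w, d, hw, hd, hb⟩
        refine ⟨u + w, c + d, hu.add hw, ?_, fun v => ?_⟩
        · filter_upwards [hc, hd] with x h1 h2
          rw [Pi.add_apply, add_mul]
          exact (abs_add_le _ _).trans (add_le_add h1 h2)
        · rw [inner_add_left, ha, hb, ← integral_add (hJ.weight.integrable_mul hu hc _)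
            (hJ.weight.integrable_mul hw hd _)]
          simp only [Pi.add_apply, add_mul]
      smul_mem' := by
        rintro r a ⟨u, c, hu, hc, ha⟩
        refine ⟨r • u, |r| * c, hu.const_smul r, ?_, fun v => ?_⟩
        · filter_upwards [hc] with x h1
          rw [Pi.smul_apply, smul_eq_mul, abs_mul, mul_assoc]
          exact mul_le_mul_of_nonneg_left h1 (abs_nonneg _)
        · rw [real_inner_smul_left, ha, ← integral_const_mul]
          simp only [Pi.smul_apply, smul_eq_mul, mul_assoc] }
  have hK : Kᗮ = ⊥ := by
    rw [Submodule.eq_bot_iff]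
    intro ξ hξ
    refine (injective_iff_map_eq_zero J).1 hJ.injective _ ?_
    refine hJ.weight.eq_zero_of_integral_mul fun u hu hc => ?_
    have hc' : ∀ᵐ x ∂m, |u x| ≤ 1 * g x := by simpa using hc
    obtain ⟨ℓ, hℓ⟩ := hJ.weight.exists_functional hu hc'
    have hζ : ∀ v, ⟪(InnerProductSpace.toDual ℝ (ExtendedSpace S)).symm (ℓ.comp J), v⟫_ℝ =
        ∫ x, u x * J v x ∂m := fun v => by
      rw [InnerProductSpace.toDual_symm_apply, ← hℓ]
      rfl
    rw [← hζ]
    exact (Submodule.mem_orthogonal _ _).1 hξ _ ⟨u, 1, hu, hc', hζ⟩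
  have hd : Dense (K : Set (ExtendedSpace S)) := Submodule.dense_iff_topologicalClosure_eq_top.2
    (Submodule.topologicalClosure_eq_top_iff.2 hK)
  have him := (InnerProductSpace.toDual ℝ (ExtendedSpace S)).surjective.denseRange.dense_image
    (InnerProductSpace.toDual ℝ (ExtendedSpace S)).continuous hd
  refine him.mono ?_
  rintro _ ⟨ζ, ⟨u, c, hu, hc, h⟩, rfl⟩
  exact ⟨u, mem_spaceV_of_le hJ hN hu hc, fun v _ => h v⟩

theorem conditionN2_of_embedding (hJ : IsL1Embedding m S g J) {N : ℝ → ℝ}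
    (hN : IsOrliczFunction N) (hΔ : IsDelta2Regular m N) : ConditionN2 J N := by
  refine ⟨dense_spaceVInDual hJ hN, fun u hu => hu.1, fun f hf ε hε => ?_⟩
  have hgm := hJ.weight.memL1.1
  obtain ⟨n, hn⟩ := hN.exists_modular_sub_clip_lt hΔ hf (φ := fun n x => (n : ℝ) * g x)
    (fun n => hgm.const_mul _)
    (fun n => hJ.weight.pos.mono fun x hx => mul_nonneg n.cast_nonneg hx.le)
    (hJ.weight.pos.mono fun x hx => tendsto_natCast_atTop_atTop.atTop_mul_const hx)
    (2 / ε) one_pos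
  refine ⟨fun x => clip (n * g x) (f x), mem_spaceV_of_le hJ hN
    (aestronglyMeasurable_clip (hgm.const_mul _) hf.1) (c := n) ?_, orliczNorm_lt hε hn.le⟩
  exact hJ.weight.pos.mono fun x hx => abs_clip_le (mul_nonneg n.cast_nonneg hx.le) _

end Density

theorem proposition3p1 {E : Type*} [MeasurableSpace E] [MeasurableSpace.CountablyGenerated E]
    (m : Measure E) [SigmaFinite m]
    (L : Lp ℝ 2 m →ₗ.[ℝ] Lp ℝ 2 m) (hL : IsSelfAdjoint L)
    (hneg : ∀ u : L.domain, ⟪L u, (u : Lp ℝ 2 m)⟫_ℝ ≤ 0)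
    (hker : ∀ u : L.domain, L u = 0 → u = 0)
    (S : Lp ℝ 2 m →ₗ.[ℝ] Lp ℝ 2 m) (hS : IsSqrtNeg L S)
    (htrans : IsTransientDirichletSpace m L S) :
    ConditionL1 m S ∧
      ∀ (g : E → ℝ) (J : ExtendedSpace S →L[ℝ] Lp ℝ 1 (weighted m g)), IsL1Embedding m S g J →
        ∀ N : ℝ → ℝ, IsYoungFunction N → IsDelta2Regular m N → IsDelta2Regular m (youngDual N) →
          ConditionN1 J N ∧ ConditionN2 J N := by
  refine ⟨conditionL1_of_transient hL hS hker htrans, fun g J hJ N hN hΔ hΔ' => ⟨?_, ?_⟩⟩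
  · exact conditionN1_of_embedding hS.selfAdjoint htrans.markovian hJ hN.isOrliczFunction_dual hΔ'
  · exact conditionN2_of_embedding hJ hN.isOrliczFunction hΔ
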